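/- Fix a principal ideal domain $R$ (the coefficient ring for homology and exterior algebras). **Precubical sets.** A precubical set is a graded set $P=(P_n)_{n\ge 0}$ with face operators $d^k_i\colon P_n\to P_{n-1}$ ($n>0$, $k\in\{0,1\}$, $1\le i\le n$) such that $d^k_i d^l_j=d^l_{j-1}d^k_i$ for $i<j$. The tensor product $P\otimes Q$ has $(P\otimes Q)_n=\coprod_{p+q=n}P_p\times Q_q$, and for $(x,y)\in P_p\times Q_q$, $d^k_i(x,y)=(d^k_ix,y)$ if $i\le p$ and $d^k_i(x,y)=(x,d^k_{i-p}y)$ if $i>p$. A path in $P$ is a finite, possibly empty, sequence of edges (elements of $P_1$), each starting ($d^0_1$) at the vertex where the preceding one ends ($d^1_1$). **HDAs.** A concurrent alphabet $(\Sigma,D)$ is a set $\Sigma$ with a reflexive and symmetric (dependence) relation $D$. Its trace monoid $M(\Sigma,D)$ is the quotient of the free monoid $\Sigma^*$ by the smallest congruence with $ab\equiv ba$ for all $(a,b)\notin D$. A higher-dimensional automaton (HDA) $\mathcal A$ consists of a precubical set $P_{\mathcal A}$, an initial state $I_{\mathcal A}\in (P_{\mathcal A})_0$, a set of final states $F_{\mathcal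 A}\subseteq (P_{\mathcal A})_0$, a concurrent alphabet $(\Sigma_{\mathcal A},D_{\mathcal A})$, and a labeling $\lambda_{\mathcal A}\colon (P_{\mathcal A})_1\to\Sigma_{\mathcal A}^*$ such that for all $x\in (P_{\mathcal A})_2$: $\lambda_{\mathcal A}(d^0_ix)=\lambda_{\mathcal A}(d^1_ix)$ for $i=1,2$; and for all $(a,b)\in D_{\mathcal A}$, the letter $a$ does not occur in $\lambda_{\mathcal A}(d^0_1x)$ or $b$ does not occur in $\lambda_{\mathcal A}(d^0_2x)$. The label $\overline\lambda_{\mathcal A}(\omega)$ of a path $\omega$ is the product of the labels of its edges. $\mathcal A$ is accessible if every vertex is the end of a path from $I_{\mathcal A}$, and coaccessible if from every vertex there is a path to a final state. **Tensor product and coproduct.** $\mathcal A\otimes\mathcal B$ has precubical set $P_{\mathcal A}\otimes P_{\mathcal B}$, initial state $(I_{\mathcal A},I_{\mathcal B})$, final states $F_{\mathcal A}\times F_{\mathcal B}$, and alphabet $\Sigma_{\mathcal A}\amalg\Sigma_{\mathcal B}$, where two letters are dependent iff they belong to the same summand and are dependent there; the label of $(x,y)$ is $\lambda_{\mathcal A}(x)$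 if $x$ is an edge and $\lambda_{\mathcal B}(y)$ if $y$ is an edge. $\mathcal A+\mathcal B$ has precubical set $P_{\mathcal A}\otimes\{I_{\mathcal B}\}\cup\{I_{\mathcal A}\}\otimes P_{\mathcal B}\subseteq P_{\mathcal A}\otimes P_{\mathcal B}$, initial state $(I_{\mathcal A},I_{\mathcal B})$, final states $F_{\mathcal A}\times\{I_{\mathcal B}\}\cup\{I_{\mathcal A}\}\times F_{\mathcal B}$, the same letters $\Sigma_{\mathcal A}\amalg\Sigma_{\mathcal B}$ and labels, and the dependence relation in which, in addition, any two letters from different summands are dependent. **Invariants.** The fundamental monoid is $\pi(\mathcal A)=\{[\overline\lambda_{\mathcal A}(\omega)] : \omega \text{ a path from } I_{\mathcal A}\text{ to } I_{\mathcal A}\}\subseteq M(\Sigma_{\mathcal A},D_{\mathcal A})$. The trace language $TL(\mathcal A)\subseteq M(\Sigma_{\mathcal A},D_{\mathcal A})$ is the set of all $v$ such that $vw=[\overline\lambda_{\mathcal A}(\omega)]$ for some $w\in M(\Sigma_{\mathcal A},D_{\mathcal A})$ and some path $\omega$ starting at $I_{\mathcal A}$. Let $C_n(P_{\mathcal A})$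 be the free $R$-module on $(P_{\mathcal A})_n$, with boundary $dx=\sum_{i=1}^n(-1)^i(d^0_ix-d^1_ix)$, and let $H_*(P_{\mathcal A})$ be its homology. For $x\in(P_{\mathcal A})_n$ let $e_ix=d^0_1\cdots d^0_{i-1}d^0_{i+1}\cdots d^0_nx\in (P_{\mathcal A})_1$, and let $\Lambda(\Sigma_{\mathcal A})$ be the exterior algebra on the free $R$-module on $\Sigma_{\mathcal A}$. The $R$-linear map $\mathfrak l_{\mathcal A}\colon C_n(P_{\mathcal A})\to\Lambda(\Sigma_{\mathcal A})$ given on cubes by $\mathfrak l_{\mathcal A}(x)=\sum_{j_1,\dots,j_n}\lambda_{\mathcal A}(e_1x)_{j_1}\wedge\dots\wedge\lambda_{\mathcal A}(e_nx)_{j_n}$, where $j_i$ runs over the positions of the word $\lambda_{\mathcal A}(e_ix)$ (so $\mathfrak l_{\mathcal A}(x)=1$ for $n=0$), vanishes on boundaries and hence induces $\ell_{\mathcal A}\colon H_*(P_{\mathcal A})\to\Lambda(\Sigma_{\mathcal A})$. The homology language is the graded module $HL(\mathcal A)=\operatorname{im}\ell_{\mathcal A}$. **Weak equivalence.** $\mathcal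 A$ weakly implements $\mathcal B$, written $\mathcal A\sqsubseteq\mathcal B$, if (1) $\mathcal A$ is accessible if $\mathcal B$ is, and coaccessible if $\mathcal B$ is; (2) $(\Sigma_{\mathcal A},D_{\mathcal A})=(\Sigma_{\mathcal B},D_{\mathcal B})$, $\pi(\mathcal A)\subseteq\pi(\mathcal B)$ and $TL(\mathcal A)\subseteq TL(\mathcal B)$; (3) $HL(\mathcal A)\subseteq HL(\mathcal B)$. $\mathcal A$ and $\mathcal B$ are weakly equivalent, $\mathcal A\simeq\mathcal B$, if $\mathcal A\sqsubseteq\mathcal B$ and $\mathcal B\sqsubseteq\mathcal A$. **Corollary.** Let $\mathcal A,\mathcal A',\mathcal B,\mathcal B'$ be HDAs such that $\mathcal A\simeq\mathcal A'$ and $\mathcal B\simeq\mathcal B'$. Then $\mathcal A\otimes\mathcal B\simeq\mathcal A'\otimes\mathcal B'$. If $\mathcal A,\mathcal A',\mathcal B,\mathcal B'$ are coaccessible, then also $\mathcal A+\mathcal B\simeq\mathcal A'+\mathcal B'$. -/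

import Mathlib

/-! ## Precubical sets -/

/-- A precubical set. The face operators `d^k_i` (`1 ≤ i ≤ n + 1`) on cubes of degree `n + 1` are
indexed by `Fin (n + 1)`, so that `face k i` is `d^k_{i+1}`. -/
structure PrecubicalSet.{u} where
  cube : ℕ → Type u
  face : ∀ {n : ℕ}, Fin 2 → Fin (n + 1) → cube (n + 1) → cube n
  face_face : ∀ {n : ℕ} (k l : Fin 2) (i j : Fin (n + 1)) (x : cube (n + 2)), i ≤ j →
    face k i (face l j.succ x) = face l j (face k i.castSucc x)

namespace PrecubicalSet

universe u v

/-- The face operators on cubes of degree `m`, for an arbitrary `m` with `Fin m` inhabited. -/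
def faceOf (P : PrecubicalSet.{u}) : ∀ {m : ℕ}, Fin 2 → Fin m → P.cube m → P.cube (m - 1)
  | _ + 1, k, i, x => P.face k i x

/-- Two consecutive faces can be interchanged, with new indices that depend only on the old ones. -/
theorem exists_face_comm (P : PrecubicalSet.{u}) {n : ℕ} (a : Fin (n + 1)) (i : Fin (n + 2)) :
    ∃ (a' : Fin (n + 2)) (i' : Fin (n + 1)), ∀ (k l : Fin 2) (x : P.cube (n + 2)),
      P.face l a (P.face k i x) = P.face k i' (P.face l a' x) := by
  by_cases h : a.castSucc < i
  · have hi : i ≠ 0 := by rintro rfl; exact absurd h (Fin.not_lt_zero _)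
    obtain ⟨j, rfl⟩ := Fin.exists_succ_eq.2 hi
    exact ⟨a.castSucc, j, fun k l x => P.face_face l k a j x (Fin.castSucc_lt_succ_iff.1 h)⟩
  · have hi : i ≠ Fin.last (n + 1) := by
      rintro rfl; exact h (Fin.castSucc_lt_last a)
    obtain ⟨j, rfl⟩ := Fin.exists_castSucc_eq.2 hi
    refine ⟨a.succ, j, fun k l x => (P.face_face k l j a x ?_).symm⟩
    exact Fin.castSucc_le_castSucc_iff.1 (not_lt.1 h)

/-- A precubical subset: a graded subset that is stable under the face operators. -/
structure Sub (P : PrecubicalSet.{u}) where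
  carrier : ∀ n : ℕ, Set (P.cube n)
  face_mem : ∀ {n : ℕ} (k : Fin 2) (i : Fin (n + 1)) (x : P.cube (n + 1)),
    x ∈ carrier (n + 1) → P.face k i x ∈ carrier n

/-- A precubical subset as a precubical set. -/
def Sub.toPrecubicalSet {P : PrecubicalSet.{u}} (S : P.Sub) : PrecubicalSet.{u} where
  cube n := S.carrier n
  face k i x := ⟨P.face k i x.1, S.face_mem k i x.1 x.2⟩
  face_face k l i j x h := Subtype.ext (P.face_face k l i j x.1 h)

/-! ### Tensor product -/

/-- A cube of degree `n` of `P ⊗ Q`: a pair `(x, y) ∈ P_p × Q_q` where `p + q = n`. -/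
structure TensorCube (P : PrecubicalSet.{u}) (Q : PrecubicalSet.{v}) (n : ℕ) : Type (max u v) where
  p : ℕ
  q : ℕ
  add_eq : p + q = n
  fst : P.cube p
  snd : Q.cube q

/-- The face operators of `P ⊗ Q`: the first `p` of them act on `x`, the other ones on `y`. -/
def TensorCube.face {P : PrecubicalSet.{u}} {Q : PrecubicalSet.{v}} {n : ℕ} (k : Fin 2)
    (i : Fin (n + 1)) (c : TensorCube P Q (n + 1)) : TensorCube P Q n :=
  if h : i.1 < c.p then
    ⟨c.p - 1, c.q, by have := c.add_eq; omega, P.faceOf k ⟨i.1, h⟩ c.fst, c.snd⟩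
  else
    ⟨c.p, c.q - 1, by have := c.add_eq; have := i.2; omega, c.fst,
      Q.faceOf k ⟨i.1 - c.p, by have := c.add_eq; have := i.2; omega⟩ c.snd⟩

theorem TensorCube.face_left {P : PrecubicalSet.{u}} {Q : PrecubicalSet.{v}} {n p q : ℕ}
    (k : Fin 2) (i : Fin (n + 1)) (h : p + 1 + q = n + 1) (x : P.cube (p + 1)) (y : Q.cube q)
    (hi : i.1 < p + 1) :
    TensorCube.face k i ⟨p + 1, q, h, x, y⟩ = ⟨p, q, by omega, P.face k ⟨i.1, hi⟩ x, y⟩ :=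
  dif_pos hi

theorem TensorCube.face_right {P : PrecubicalSet.{u}} {Q : PrecubicalSet.{v}} {n p q : ℕ}
    (k : Fin 2) (i : Fin (n + 1)) (h : p + (q + 1) = n + 1) (x : P.cube p) (y : Q.cube (q + 1))
    (hi : p ≤ i.1) :
    TensorCube.face k i ⟨p, q + 1, h, x, y⟩ =
      ⟨p, q, by omega, x, Q.face k ⟨i.1 - p, by have := i.2; omega⟩ y⟩ :=
  dif_neg (not_lt.2 hi)

/-- The tensor product of precubical sets. -/
def tensor (P : PrecubicalSet.{u}) (Q : PrecubicalSet.{v}) : PrecubicalSet.{max u v} where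
  cube := TensorCube P Q
  face := TensorCube.face
  face_face := by
    rintro n k l ⟨i, hi⟩ ⟨j, hj⟩ ⟨p, q, hpq, x, y⟩ hij
    have hij : i ≤ j := hij
    by_cases h1 : j + 1 < p
    · obtain ⟨p, rfl⟩ : ∃ p', p = p' + 2 := ⟨p - 2, by omega⟩
      rw [TensorCube.face_left (hi := h1), TensorCube.face_left (hi := show i < p + 1 by omega),
        TensorCube.face_left (hi := show i < p + 2 by omega),
        TensorCube.face_left (hi := show j < p + 1 by omega)]
      exact congrArg (fun z => (⟨p, q, by omega, z, y⟩ : TensorCube P Q n))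
        (P.face_face k l ⟨i, by omega⟩ ⟨j, by omega⟩ x hij)
    · by_cases h2 : i < p
      · obtain ⟨p, rfl⟩ : ∃ p', p = p' + 1 := ⟨p - 1, by omega⟩
        obtain ⟨q, rfl⟩ : ∃ q', q = q' + 1 := ⟨q - 1, by omega⟩
        rw [TensorCube.face_right (hi := show p + 1 ≤ j + 1 by omega),
          TensorCube.face_left (hi := h2), TensorCube.face_left (hi := h2),
          TensorCube.face_right (hi := show p ≤ j by omega)]
        simp only [Fin.succ_mk, Fin.castSucc_mk, Nat.add_sub_add_right]
      · obtain ⟨q, rfl⟩ : ∃ q', q = q' + 2 := ⟨q - 2, by omega⟩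
        rw [TensorCube.face_right (hi := show p ≤ j + 1 by omega),
          TensorCube.face_right (hi := show p ≤ i by omega),
          TensorCube.face_right (hi := show p ≤ i by omega),
          TensorCube.face_right (hi := show p ≤ j by omega)]
        have := Q.face_face k l ⟨i - p, by omega⟩ ⟨j - p, by omega⟩ y
          (by show i - p ≤ j - p; omega)
        have e : j + 1 - p = j - p + 1 := by omega
        simp only [Fin.succ_mk, Fin.castSucc_mk, e] at this ⊢
        exact congrArg (fun z => (⟨p, q, by omega, x, z⟩ : TensorCube P Q n)) this

/-! ### Paths -/

/-- Paths from one vertex to another: finite (possibly empty) sequences of edges in which every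
edge starts where the preceding one ends. -/
inductive Path (P : PrecubicalSet.{u}) : P.cube 0 → P.cube 0 → Type u
  | nil (v : P.cube 0) : Path P v v
  | cons {v w : P.cube 0} (x : P.cube 1) (hx : P.face 0 0 x = v) (ω : Path P (P.face 1 0 x) w) :
      Path P v w

/-- Concatenation of paths. -/
def Path.comp {P : PrecubicalSet.{u}} : ∀ {v w z : P.cube 0}, P.Path v w → P.Path w z → P.Path v z
  | _, _, _, .nil _, ν => ν
  | _, _, _, .cons x hx ω, ν => .cons x hx (ω.comp ν)

/-! ### Cubical homology -/

section Homology

variable (P : PrecubicalSet.{u}) (R : Type v) [CommRing R]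

/-- The module of cubical chains of degree `n`: the free module generated by the `n`-cubes. -/
def Chain (n : ℕ) : Type (max u v) := P.cube n →₀ R

noncomputable instance (n : ℕ) : AddCommGroup (P.Chain R n) :=
  inferInstanceAs (AddCommGroup (P.cube n →₀ R))

noncomputable instance (n : ℕ) : Module R (P.Chain R n) :=
  inferInstanceAs (Module R (P.cube n →₀ R))

/-- The basis of the module of chains given by the cubes. -/
noncomputable def cubeBasis (n : ℕ) : Module.Basis (P.cube n) R (P.Chain R n) :=
  Module.Basis.ofRepr (LinearEquiv.refl R (P.cube n →₀ R))

/-- The boundary operator `d x = ∑_{i=1}^{n+1} (-1)^i (d^0_i x - d^1_i x)` on chains of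
degree `n + 1`. -/
noncomputable def boundary (n : ℕ) : P.Chain R (n + 1) →ₗ[R] P.Chain R n :=
  (P.cubeBasis R (n + 1)).constr R fun x =>
    ∑ i : Fin (n + 1), (-1 : R) ^ (i.1 + 1) •
      (P.cubeBasis R n (P.face 0 i x) - P.cubeBasis R n (P.face 1 i x))

theorem boundary_boundary (n : ℕ)
    (z : P.Chain R (n + 2)) : P.boundary R n (P.boundary R (n + 1) z) = 0 := by
  have key : P.boundary R n ∘ₗ P.boundary R (n + 1) = 0 := by
    refine (P.cubeBasis R (n + 2)).ext fun x => ?_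
    simp only [boundary, LinearMap.comp_apply, Module.Basis.constr_basis, map_sum, map_smul,
      map_sub, LinearMap.zero_apply]
    simp only [← Finset.sum_sub_distrib, Finset.smul_sum, ← smul_sub, smul_smul]
    rw [← Finset.sum_product']
    refine Finset.sum_involution (fun a _ => if h : a.2.castSucc < a.1
      then (a.2.castSucc, a.1.pred (Fin.ne_zero_of_lt h))
      else (a.2.succ, a.1.castPred (Fin.ne_last_of_lt (lt_of_le_of_lt (not_lt.1 h)
        (Fin.castSucc_lt_last _))))) ?_ ?_ ?_ ?_
    · rintro ⟨j, i⟩ -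
      by_cases h : i.castSucc < j
      · obtain ⟨j, rfl⟩ := Fin.exists_succ_eq.2 (Fin.ne_zero_of_lt h)
        have hij := Fin.castSucc_lt_succ_iff.1 h
        simp only [h, dite_true, Fin.pred_succ, P.face_face _ _ i j x hij, Fin.val_succ,
          Fin.val_castSucc]
        module
      · obtain ⟨j, rfl⟩ := Fin.exists_castSucc_eq.2 (Fin.ne_last_of_lt (lt_of_le_of_lt (not_lt.1 h)
          (Fin.castSucc_lt_last _)))
        have hij := Fin.castSucc_le_castSucc_iff.1 (not_lt.1 h)
        simp only [h, dite_false, Fin.castPred_castSucc, P.face_face _ _ j i x hij, Fin.val_succ,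
          Fin.val_castSucc]
        module
    · rintro ⟨j, i⟩ - - heq
      by_cases h : i.castSucc < j
      · simp only [h, dite_true, Prod.mk.injEq] at heq
        exact absurd heq.1 h.ne
      · simp only [h, dite_false, Prod.mk.injEq] at heq
        exact h (heq.1 ▸ Fin.castSucc_lt_succ)
    · simp
    · rintro ⟨j, i⟩ -
      by_cases h : i.castSucc < j
      · obtain ⟨j, rfl⟩ := Fin.exists_succ_eq.2 (Fin.ne_zero_of_lt h)
        have hij := Fin.castSucc_lt_succ_iff.1 h
        simp [h, not_lt.2 hij]
      · obtain ⟨j, rfl⟩ := Fin.exists_castSucc_eq.2 (Fin.ne_last_of_lt (lt_of_le_of_lt (not_lt.1 h)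
          (Fin.castSucc_lt_last _)))
        have hij := Fin.castSucc_le_castSucc_iff.1 (not_lt.1 h)
        simp [h, Fin.castSucc_lt_succ_iff, hij]
  exact LinearMap.congr_fun key z

/-- The cycles; every chain of degree `0` is a cycle. -/
noncomputable def cycles : ∀ n : ℕ, Submodule R (P.Chain R n)
  | 0 => ⊤
  | n + 1 => LinearMap.ker (P.boundary R n)

/-- The cubical homology `H_n(P)`: cycles modulo boundaries. -/
abbrev Homology (n : ℕ) : Type (max u v) :=
  ↥(P.cycles R n) ⧸ (LinearMap.range (P.boundary R n)).submoduleOf (P.cycles R n)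

end Homology

/-! ### Starting edges -/

/-- The starting edges `e_i x = d^0_1 ⋯ d^0_{i-1} d^0_{i+1} ⋯ d^0_n x` of an `n`-cube `x`,
with `i` indexed by `Fin n`. -/
def startEdge (P : PrecubicalSet.{u}) : ∀ {n : ℕ}, P.cube n → Fin n → P.cube 1
  | 1, x, _ => x
  | n + 2, x, i =>
    if h : i = Fin.last (n + 1) then
      P.startEdge (P.face 0 (Fin.last n).castSucc x) (Fin.last n)
    else
      P.startEdge (P.face 0 (Fin.last (n + 1)) x) (i.castPred h)

end PrecubicalSet

/-! ## Concurrent alphabets and trace monoids -/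

/-- A concurrent alphabet: a set of letters with a reflexive and symmetric dependence relation. -/
structure ConcurrentAlphabet.{w} where
  Letter : Type w
  Dep : Letter → Letter → Prop
  refl : ∀ a, Dep a a
  symm : ∀ a b, Dep a b → Dep b a

namespace ConcurrentAlphabet

universe w w₁ w₂

/-- The relation `ab ∼ ba` on words, for independent letters `a` and `b`. -/
def commRel (S : ConcurrentAlphabet.{w}) (u v : FreeMonoid S.Letter) : Prop :=
  ∃ a b : S.Letter, ¬ S.Dep a b ∧
    u = FreeMonoid.of a * FreeMonoid.of b ∧ v = FreeMonoid.of b * FreeMonoid.of a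

/-- The trace monoid: words modulo the smallest congruence that lets independent letters
commute. -/
abbrev TraceMonoid (S : ConcurrentAlphabet.{w}) : Type w := PresentedMonoid S.commRel

/-- The trace `[u]` of a word `u`. -/
abbrev trace (S : ConcurrentAlphabet.{w}) : FreeMonoid S.Letter →* S.TraceMonoid :=
  PresentedMonoid.mk S.commRel

/-- The tensor product: letters from different sides are independent. -/
def tensor (S : ConcurrentAlphabet.{w₁}) (T : ConcurrentAlphabet.{w₂}) :
    ConcurrentAlphabet.{max w₁ w₂} where
  Letter := S.Letter ⊕ T.Letter
  Dep
    | .inl a, .inl b => S.Dep a b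
    | .inr a, .inr b => T.Dep a b
    | .inl _, .inr _ => False
    | .inr _, .inl _ => False
  refl := by rintro (a | a); exacts [S.refl a, T.refl a]
  symm := by
    rintro (a | a) (b | b) h
    exacts [S.symm a b h, h.elim, h.elim, T.symm a b h]

/-- The coproduct: letters from different sides are dependent. -/
def coprod (S : ConcurrentAlphabet.{w₁}) (T : ConcurrentAlphabet.{w₂}) :
    ConcurrentAlphabet.{max w₁ w₂} where
  Letter := S.Letter ⊕ T.Letter
  Dep
    | .inl a, .inl b => S.Dep a b
    | .inr a, .inr b => T.Dep a b
    | .inl _, .inr _ => True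
    | .inr _, .inl _ => True
  refl := by rintro (a | a); exacts [S.refl a, T.refl a]
  symm := by
    rintro (a | a) (b | b) h
    exacts [S.symm a b h, trivial, trivial, T.symm a b h]

end ConcurrentAlphabet

/-! ## Higher-dimensional automata -/

/-- A higher-dimensional automaton over a concurrent alphabet. -/
structure HDA.{u, w} where
  P : PrecubicalSet.{u}
  init : P.cube 0
  final : Set (P.cube 0)
  alph : ConcurrentAlphabet.{w}
  label : P.cube 1 → FreeMonoid alph.Letter
  label_face : ∀ (x : P.cube 2) (i : Fin 2), label (P.face 0 i x) = label (P.face 1 i x)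
  label_indep : ∀ (x : P.cube 2) (a b : alph.Letter), alph.Dep a b →
    a ∉ (label (P.face 0 0 x)).toList ∨ b ∉ (label (P.face 0 1 x)).toList

namespace HDA

universe u u₁ u₂ v w w₁ w₂

open PrecubicalSet

/-! ### Tensor product and coproduct -/

/-- The label of an edge of `P_A ⊗ P_B`, as a word over the disjoint union of the alphabets. -/
def pairLabel (A : HDA.{u₁, w₁}) (B : HDA.{u₂, w₂}) :
    TensorCube A.P B.P 1 → FreeMonoid (A.alph.Letter ⊕ B.alph.Letter)
  | ⟨1, 0, _, x, _⟩ => FreeMonoid.map Sum.inl (A.label x)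
  | ⟨0, 1, _, _, y⟩ => FreeMonoid.map Sum.inr (B.label y)
  | ⟨0, 0, h, _, _⟩ => absurd h (by omega)
  | ⟨0, _ + 2, h, _, _⟩ => absurd h (by omega)
  | ⟨1, _ + 1, h, _, _⟩ => absurd h (by omega)
  | ⟨_ + 2, _, h, _, _⟩ => absurd h (by omega)

theorem pairLabel_face (A : HDA.{u₁, w₁}) (B : HDA.{u₂, w₂}) (c : TensorCube A.P B.P 2)
    (i : Fin 2) : pairLabel A B (c.face 0 i) = pairLabel A B (c.face 1 i) := by
  obtain ⟨p, q, h, x, y⟩ := c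
  obtain ⟨rfl, rfl⟩ | ⟨rfl, rfl⟩ | ⟨rfl, rfl⟩ :
      (p = 2 ∧ q = 0) ∨ (p = 1 ∧ q = 1) ∨ (p = 0 ∧ q = 2) := by omega
  · have := congrArg (FreeMonoid.map (Sum.inl (β := B.alph.Letter))) (A.label_face x i)
    fin_cases i <;> exact this
  · fin_cases i <;> rfl
  · have := congrArg (FreeMonoid.map (Sum.inr (α := A.alph.Letter))) (B.label_face y i)
    fin_cases i <;> exact this

/-- The tensor product of HDAs. -/
def tensor (A : HDA.{u₁, w₁}) (B : HDA.{u₂, w₂}) : HDA.{max u₁ u₂, max w₁ w₂} where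
  P := A.P.tensor B.P
  init := (⟨0, 0, rfl, A.init, B.init⟩ : TensorCube A.P B.P 0)
  final := {c | ∃ x ∈ A.final, ∃ y ∈ B.final, c = (⟨0, 0, rfl, x, y⟩ : TensorCube A.P B.P 0)}
  alph := A.alph.tensor B.alph
  label := pairLabel A B
  label_face := pairLabel_face A B
  label_indep := by
    rintro ⟨p, q, h, x, y⟩ (a : A.alph.Letter ⊕ B.alph.Letter) (b : A.alph.Letter ⊕ B.alph.Letter) hab
    obtain ⟨rfl, rfl⟩ | ⟨rfl, rfl⟩ | ⟨rfl, rfl⟩ :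
        (p = 2 ∧ q = 0) ∨ (p = 1 ∧ q = 1) ∨ (p = 0 ∧ q = 2) := by omega
    · show a ∉ List.map Sum.inl (A.label (A.P.face 0 0 x)).toList ∨
        b ∉ List.map Sum.inl (A.label (A.P.face 0 1 x)).toList
      rcases a with a | a <;> rcases b with b | b
      · simpa using A.label_indep x a b hab
      all_goals simp
    · show a ∉ List.map Sum.inr (B.label y).toList ∨ b ∉ List.map Sum.inl (A.label x).toList
      rcases a with a | a <;> rcases b with b | b
      · simp
      · simp
      · exact hab.elim
      · simp
    · show a ∉ List.map Sum.inr (B.label (B.P.face 0 0 y)).toList ∨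
        b ∉ List.map Sum.inr (B.label (B.P.face 0 1 y)).toList
      rcases a with a | a <;> rcases b with b | b
      on_goal 4 => simpa using B.label_indep y a b hab
      all_goals simp

/-- The precubical subset `P_A ⊗ {I_B} ∪ {I_A} ⊗ P_B` of `P_A ⊗ P_B`. -/
def wedge (A : HDA.{u₁, w₁}) (B : HDA.{u₂, w₂}) : (A.P.tensor B.P).Sub where
  carrier n := {c | (∃ x : A.P.cube n, c = (⟨n, 0, rfl, x, B.init⟩ : TensorCube A.P B.P n)) ∨
    ∃ y : B.P.cube n, c = (⟨0, n, Nat.zero_add n, A.init, y⟩ : TensorCube A.P B.P n)}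
  face_mem := by
    rintro n k ⟨i, hi⟩ c (⟨x, rfl⟩ | ⟨y, rfl⟩)
    · refine Or.inl ⟨A.P.face k ⟨i, hi⟩ x, ?_⟩
      simp [PrecubicalSet.tensor, TensorCube.face, faceOf, hi]
    · refine Or.inr ⟨B.P.face k ⟨i, hi⟩ y, ?_⟩
      simp [PrecubicalSet.tensor, TensorCube.face, faceOf]

/-- The coproduct of HDAs. -/
def coprod (A : HDA.{u₁, w₁}) (B : HDA.{u₂, w₂}) : HDA.{max u₁ u₂, max w₁ w₂} where
  P := (wedge A B).toPrecubicalSet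
  init := ⟨(⟨0, 0, rfl, A.init, B.init⟩ : TensorCube A.P B.P 0), Or.inl ⟨A.init, rfl⟩⟩
  final := {c | (∃ x ∈ A.final, c.1 = (⟨0, 0, rfl, x, B.init⟩ : TensorCube A.P B.P 0)) ∨
    ∃ y ∈ B.final, c.1 = (⟨0, 0, rfl, A.init, y⟩ : TensorCube A.P B.P 0)}
  alph := A.alph.coprod B.alph
  label c := pairLabel A B c.1
  label_face c := pairLabel_face A B c.1
  label_indep := by
    rintro ⟨c, ⟨x, rfl⟩ | ⟨y, rfl⟩⟩ (a : A.alph.Letter ⊕ B.alph.Letter) (b : A.alph.Letter ⊕ B.alph.Letter) hab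
    · show a ∉ List.map Sum.inl (A.label (A.P.face 0 0 x)).toList ∨
        b ∉ List.map Sum.inl (A.label (A.P.face 0 1 x)).toList
      rcases a with a | a <;> rcases b with b | b
      · simpa using A.label_indep x a b hab
      all_goals simp
    · show a ∉ List.map Sum.inr (B.label (B.P.face 0 0 y)).toList ∨
        b ∉ List.map Sum.inr (B.label (B.P.face 0 1 y)).toList
      rcases a with a | a <;> rcases b with b | b
      on_goal 4 => simpa using B.label_indep y a b hab
      all_goals simp

/-! ### Labels of paths, accessibility, trace language, fundamental monoid -/

/-- The extended labeling function on paths. -/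
def pathLabel (A : HDA.{u, w}) : ∀ {v w : A.P.cube 0}, A.P.Path v w → FreeMonoid A.alph.Letter
  | _, _, .nil _ => 1
  | _, _, .cons x _ ω => A.label x * A.pathLabel ω

theorem pathLabel_comp (A : HDA.{u, w}) {v w z : A.P.cube 0} (ω : A.P.Path v w)
    (ν : A.P.Path w z) : A.pathLabel (ω.comp ν) = A.pathLabel ω * A.pathLabel ν := by
  induction ω with
  | nil v => simp [Path.comp, pathLabel]
  | cons x hx ω ih => simp [Path.comp, pathLabel, ih, mul_assoc]

/-- All states are reachable from the initial state. -/
def Accessible (A : HDA.{u, w}) : Prop :=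
  ∀ x : A.P.cube 0, Nonempty (A.P.Path A.init x)

/-- From every state there is a path to a final state. -/
def Coaccessible (A : HDA.{u, w}) : Prop :=
  ∀ x : A.P.cube 0, ∃ y ∈ A.final, Nonempty (A.P.Path x y)

/-- The trace language: all prefixes of traces of labels of paths from the initial state. -/
def traceLanguage (A : HDA.{u, w}) : Set A.alph.TraceMonoid :=
  {v | ∃ (x : A.P.cube 0) (ω : A.P.Path A.init x) (t : A.alph.TraceMonoid),
    A.alph.trace (A.pathLabel ω) = v * t}

/-- The fundamental monoid: the traces of labels of loops at the initial state. -/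
def fundamentalMonoid (A : HDA.{u, w}) : Submonoid A.alph.TraceMonoid where
  carrier := {m | ∃ ω : A.P.Path A.init A.init, A.alph.trace (A.pathLabel ω) = m}
  one_mem' := ⟨.nil _, map_one _⟩
  mul_mem' := by
    rintro _ _ ⟨ω, rfl⟩ ⟨ν, rfl⟩
    exact ⟨ω.comp ν, by rw [pathLabel_comp, map_mul]⟩

/-! ### Labeled homology and homology language -/

section HomologyLanguage

variable (R : Type v) [CommRing R]

/-- The exterior algebra on the free module generated by the letters. -/
abbrev Ext (S : ConcurrentAlphabet.{w}) : Type (max v w) := ExteriorAlgebra R (S.Letter →₀ R)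

/-- For words `m₁, …, m_n`, the sum of all `(m₁)_{j_1} ∧ ⋯ ∧ (m_n)_{j_n}`
(which is `1` for `n = 0`). -/
noncomputable def wordWedge (S : ConcurrentAlphabet.{w}) {n : ℕ}
    (m : Fin n → FreeMonoid S.Letter) : Ext R S :=
  ∑ j : (i : Fin n) → Fin (m i).toList.length,
    ExteriorAlgebra.ιMulti R n fun i => Finsupp.single ((m i).toList.get (j i)) (1 : R)

/-- The labeling chain map in degree `n`, given on an `n`-cube `x` by the sum of all
`λ(e_1 x)_{j_1} ∧ ⋯ ∧ λ(e_n x)_{j_n}`. -/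
noncomputable def labeling (A : HDA.{u, w}) (n : ℕ) : A.P.Chain R n →ₗ[R] Ext R A.alph :=
  (A.P.cubeBasis R n).constr R fun x =>
    wordWedge R A.alph fun i => A.label (A.P.startEdge x i)

theorem label_startEdge_face (A : HDA.{u, w}) : ∀ {n : ℕ} (x : A.P.cube (n + 1)) (i : Fin (n + 1))
    (j : Fin n), A.label (A.P.startEdge (A.P.face 0 i x) j) =
      A.label (A.P.startEdge (A.P.face 1 i x) j)
  | 0, _, _, j => j.elim0
  | 1, x, i, _ => A.label_face x i
  | n + 2, x, i, j => by
    by_cases h : j = Fin.last (n + 1)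
    · obtain ⟨a', i', H⟩ := A.P.exists_face_comm (Fin.last n).castSucc i
      simp only [startEdge, h, dite_true, H]
      exact label_startEdge_face A _ i' _
    · obtain ⟨a', i', H⟩ := A.P.exists_face_comm (Fin.last (n + 1)) i
      simp only [startEdge, h, dite_false, H]
      exact label_startEdge_face A _ i' _

/-- The labeling chain map is a chain map to the exterior algebra with zero differential. -/
theorem labeling_boundary (A : HDA.{u, w}) (n : ℕ) (z : A.P.Chain R (n + 1)) :
    labeling R A n (A.P.boundary R n z) = 0 := by
  have key : labeling R A n ∘ₗ A.P.boundary R n = 0 := by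
    refine (A.P.cubeBasis R (n + 1)).ext fun x => ?_
    simp [boundary, labeling, Module.Basis.constr_basis, label_startEdge_face A x]
  exact LinearMap.congr_fun key z

/-- The map `ℓ_A` in degree `n`, which sends a homology class `[z]` to the label of `z`. -/
noncomputable def homologyLabeling (A : HDA.{u, w}) (n : ℕ) :
    A.P.Homology R n →ₗ[R] Ext R A.alph :=
  Submodule.liftQ _ (labeling R A n ∘ₗ (A.P.cycles R n).subtype) <| by
    rintro ⟨z, hz⟩ ⟨y, rfl⟩
    exact labeling_boundary R A n y

/-- The homology language, a graded submodule of the exterior algebra, in degree `n`. -/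
noncomputable def homologyLanguage (A : HDA.{u, w}) (n : ℕ) : Submodule R (Ext R A.alph) :=
  LinearMap.range (homologyLabeling R A n)

end HomologyLanguage

/-! ### Weak implementation and weak equivalence -/

/-- `A` weakly implements `B` (with respect to the coefficient ring `R`). -/
def WeaklyImplements (R : Type v) [CommRing R] (A : HDA.{u₁, w}) (B : HDA.{u₂, w}) : Prop :=
  ((B.Accessible → A.Accessible) ∧ (B.Coaccessible → A.Coaccessible)) ∧
  ∃ h : A.alph = B.alph,
    ((h ▸ A.fundamentalMonoid : Submonoid B.alph.TraceMonoid) ≤ B.fundamentalMonoid ∧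
      (h ▸ A.traceLanguage : Set B.alph.TraceMonoid) ⊆ B.traceLanguage) ∧
    ∀ n : ℕ, (h ▸ homologyLanguage R A n : Submodule R (Ext R B.alph)) ≤ homologyLanguage R B n

/-- Weak equivalence of HDAs (with respect to the coefficient ring `R`). -/
def WeaklyEquivalent (R : Type v) [CommRing R] (A : HDA.{u₁, w}) (B : HDA.{u₂, w}) : Prop :=
  WeaklyImplements R A B ∧ WeaklyImplements R B A

end HDA

universe r u₁ u₂ u₃ u₄ w₁ w₂

/-! Every invariant that occurs in weak implementation is computed, for `A.tensor B` and `A.coprod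
B`, by a formula that is monotone in the invariants of `A` and `B`. Hence weak implementation is
preserved by both constructions, and weak equivalence follows by using this in both directions.

Tensor product, traces. The trace monoid is the direct product of the two trace monoids
(`tensor_eq_inl_mul_inr`), and a path is a shuffle of a path in `A` and a path in `B`
(`exists_paths_of_tensor`). So membership in the fundamental monoid or the trace language is tested
on the two projections.

Tensor product, homology. The homology language is spanned by the products of homology labels of the
factors (`homologyLanguage_tensor`). Products of cycles give one inclusion. For the other, the
Künneth theorem would leave a torsion term, which cannot be seen in the flat exterior algebra. The
proof avoids that theorem: over a PID the cycles are a retract of the chains, so the labeling of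
cycles extends to a map `g` on all chains with values in the homology language. On a cycle of the
tensor product, the labeling may be replaced by `g` in one factor at a time, because the difference
kills cycles and therefore factors through the boundary.

Coproduct. The summands meet only in the initial vertex, so a path from there is a product of loops
in the summands followed by a path in one summand (`CoprodReach`). The fundamental monoid is
generated by the two given ones, and the trace language is determined by the four invariants. The
homology language is the sum, by the chain maps that collapse one summand. Coaccessibility of a
coproduct does not descend to the summands, since a state may return to the initial state and finish
in the other summand; hence the additional hypothesis. -/

/-! ## Linear algebra -/

section LinearAlgebra

open TensorProduct

variable {R : Type*} [CommRing R]

/-- If `f` kills the cycles of `d`, if `g` kills the boundaries of `d'` and takes values in a flat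
module, then `f ⊗ g` kills every tensor `w` for which `(d ⊗ 1) w` is in the range of `1 ⊗ d'`. -/
theorem TensorProduct.map_eq_zero_of_rTensor_mem_range {C D C' D' M N : Type*}
    [AddCommGroup C] [Module R C] [AddCommGroup D] [Module R D]
    [AddCommGroup C'] [Module R C'] [AddCommGroup D'] [Module R D']
    [AddCommGroup M] [Module R M] [AddCommGroup N] [Module R N] [Module.Flat R N]
    {d : C →ₗ[R] D} {f : C →ₗ[R] M} (hf : LinearMap.ker d ≤ LinearMap.ker f)
    {d' : D' →ₗ[R] C'} {g : C' →ₗ[R] N} (hg : g ∘ₗ d' = 0) {w : C ⊗[R] C'}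
    (hw : d.rTensor C' w ∈ LinearMap.range (d'.lTensor D)) :
    TensorProduct.map f g w = 0 := by
  obtain ⟨u, hu⟩ := hw
  set h : LinearMap.range d →ₗ[R] M :=
    (LinearMap.ker d).liftQ f hf ∘ₗ d.quotKerEquivRange.symm.toLinearMap with hh
  -- Since `f` kills the kernel of `d`, it factors through the range of `d`.
  have hfh : f = h ∘ₗ d.rangeRestrict := by
    ext c
    have : d.quotKerEquivRange.symm (d.rangeRestrict c) = (LinearMap.ker d).mkQ c := by
      rw [LinearEquiv.symm_apply_eq]; rfl
    simp [hh, this]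
  -- Flatness of `N` allows this to be checked in `D ⊗ N`, where it reads `(d ⊗ g) w = (1 ⊗ g) (1 ⊗
  -- d') u = 0`.
  have key : d.rangeRestrict.rTensor N (g.lTensor C w) = 0 := by
    apply Module.Flat.rTensor_preserves_injective_linearMap (M := N) (LinearMap.range d).subtype
      (Submodule.injective_subtype _)
    rw [← LinearMap.comp_apply, ← LinearMap.rTensor_comp, LinearMap.subtype_comp_codRestrict,
      ← LinearMap.comp_apply, LinearMap.rTensor_comp_lTensor, ← LinearMap.lTensor_comp_rTensor,
      LinearMap.comp_apply, ← hu, ← LinearMap.comp_apply, ← LinearMap.lTensor_comp, hg]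
    simp
  have : TensorProduct.map f g w = h.rTensor N (d.rangeRestrict.rTensor N (g.lTensor C w)) := by
    rw [hfh, ← LinearMap.comp_apply, ← LinearMap.comp_apply, ← LinearMap.rTensor_comp,
      LinearMap.rTensor_comp_lTensor]
  rw [this, key, map_zero]

/-- The mirror image of `TensorProduct.map_eq_zero_of_rTensor_mem_range`. -/
theorem TensorProduct.map_eq_zero_of_lTensor_mem_range {C D C' D' M N : Type*}
    [AddCommGroup C] [Module R C] [AddCommGroup D] [Module R D]
    [AddCommGroup C'] [Module R C'] [AddCommGroup D'] [Module R D']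
    [AddCommGroup M] [Module R M] [AddCommGroup N] [Module R N] [Module.Flat R N]
    {d : C →ₗ[R] D} {f : C →ₗ[R] M} (hf : LinearMap.ker d ≤ LinearMap.ker f)
    {d' : D' →ₗ[R] C'} {g : C' →ₗ[R] N} (hg : g ∘ₗ d' = 0) {w : C' ⊗[R] C}
    (hw : d.lTensor C' w ∈ LinearMap.range (d'.rTensor D)) :
    TensorProduct.map g f w = 0 := by
  obtain ⟨u, hu⟩ := hw
  have h : TensorProduct.map f g (TensorProduct.comm R C' C w) = 0 := by
    refine TensorProduct.map_eq_zero_of_rTensor_mem_range hf hg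
      ⟨TensorProduct.comm R D' D u, ?_⟩
    have h1 : d'.lTensor D ∘ₗ (TensorProduct.comm R D' D).toLinearMap =
      (TensorProduct.comm R C' D).toLinearMap ∘ₗ d'.rTensor D := by ext; simp
    have h2 : d.rTensor C' ∘ₗ (TensorProduct.comm R C' C).toLinearMap =
      (TensorProduct.comm R C' D).toLinearMap ∘ₗ d.lTensor C' := by ext; simp
    have h1 := LinearMap.congr_fun h1 u
    have h2 := LinearMap.congr_fun h2 w
    simp only [LinearMap.comp_apply, LinearEquiv.coe_coe] at h1 h2
    rw [h1, h2, hu]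
  have h3 : TensorProduct.map f g ∘ₗ (TensorProduct.comm R C' C).toLinearMap =
      (TensorProduct.comm R N M).toLinearMap ∘ₗ TensorProduct.map g f := by ext; simp
  have h3 := LinearMap.congr_fun h3 w
  simp only [LinearMap.comp_apply, LinearEquiv.coe_coe] at h3
  rw [h] at h3
  exact ((TensorProduct.comm R N M).map_eq_zero_iff).1 h3.symm

/-- A submodule of a free module over a principal ideal domain is free. -/
theorem Finsupp.free_submodule_of_isPrincipalIdealRing {R ι : Type*} [CommRing R] [IsDomain R]
    [IsPrincipalIdealRing R] (N : Submodule R (ι →₀ R)) : Module.Free R N := by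
  classical
  obtain ⟨_, _⟩ := exists_wellFoundedLT ι
  -- For a well-order on `ι`, `F i` consists of the elements of `N` supported on indices up to `i`.
  -- The `i`-th coefficients on `F i` form an ideal with generator `a i`, attained at `v i`; the `v
  -- i` with `a i ≠ 0` will be a basis.
  let F (i : ι) : Submodule R (ι →₀ R) :=
    { carrier := {n | n ∈ N ∧ ∀ j, i < j → n j = 0}
      add_mem' := fun h h' => ⟨N.add_mem h.1 h'.1, fun j hj => by simp [h.2 j hj, h'.2 j hj]⟩
      zero_mem' := ⟨N.zero_mem, fun _ _ => rfl⟩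
      smul_mem' := fun r n h => ⟨N.smul_mem r h.1, fun j hj => by simp [h.2 j hj]⟩ }
  obtain ⟨a, ha⟩ : ∃ a : ι → R, ∀ i, (∃ v ∈ F i, v i = a i) ∧ ∀ n ∈ F i, ∃ r, n i = r * a i := by
    refine ⟨fun i => Submodule.IsPrincipal.generator ((F i).map (Finsupp.lapply i)), fun i =>
      ⟨Submodule.IsPrincipal.generator_mem ((F i).map (Finsupp.lapply i)), fun n hn => ?_⟩⟩
    obtain ⟨r, hr⟩ := (Submodule.IsPrincipal.mem_iff_eq_smul_generator
      ((F i).map (Finsupp.lapply i))).1 (Submodule.mem_map_of_mem hn)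
    exact ⟨r, hr⟩
  choose v hv hva using fun i => (ha i).1
  -- In a vanishing combination, only the largest index `j` that occurs contributes to the
  -- coordinate `j`, and its contribution `c j * a j` is nonzero in a domain.
  have indep : LinearIndependent R fun j : {i // a i ≠ 0} => v j := by
    rw [linearIndependent_iff]
    intro c hc
    by_contra h
    obtain ⟨j, hj, hmax⟩ := c.support.exists_max_image id (Finsupp.support_nonempty_iff.2 h)
    have h1 : Finsupp.linearCombination R (fun j : {i // a i ≠ 0} => v j) c j = c j * a j := by
      rw [Finsupp.linearCombination_apply, Finsupp.sum, Finsupp.finsetSum_apply,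
        Finset.sum_eq_single_of_mem j hj]
      · simp [hva]
      · intro k hk hkj
        have : k.1 < j.1 := lt_of_le_of_ne (hmax k hk) fun e => hkj (Subtype.ext e)
        simp [(hv k).2 j this]
    rw [hc] at h1
    exact mul_ne_zero (Finsupp.mem_support_iff.1 hj) j.2 h1.symm
  let b (j : {i // a i ≠ 0}) : N := ⟨v j, (hv j).1⟩
  -- Transfinite induction on the leading index: subtracting a multiple of `v i` removes the
  -- coefficient at `i`, and what remains is zero or lies in some `F j` with `j < i`.
  have span : ∀ i, ∀ n (hn : n ∈ F i), (⟨n, hn.1⟩ : N) ∈ Submodule.span R (Set.range b) := by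
    intro i
    induction i using WellFoundedLT.induction with
    | ind i ih =>
      have key : ∀ n ∈ F i, n i = 0 → ∀ hn : n ∈ N,
          (⟨n, hn⟩ : N) ∈ Submodule.span R (Set.range b) := by
        intro n hn h0 hnN
        by_cases h : n = 0
        · subst h; exact Submodule.zero_mem _
        obtain ⟨j, hj, hmax⟩ := n.support.exists_max_image id (Finsupp.support_nonempty_iff.2 h)
        have hji : j < i := by
          rcases lt_trichotomy j i with h | rfl | h
          · exact h
          · exact absurd h0 (Finsupp.mem_support_iff.1 hj)
          · exact absurd (hn.2 j h) (Finsupp.mem_support_iff.1 hj)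
        exact ih j hji n ⟨hnN, fun k hk => by
          by_contra hk'
          exact absurd (hmax k (Finsupp.mem_support_iff.2 hk')) (not_le.2 hk)⟩
      intro n hn
      obtain ⟨r, hr⟩ := (ha i).2 n hn
      by_cases hai : a i = 0
      · exact key n hn (by rw [hr, hai, mul_zero]) hn.1
      · have h1 := key (n - r • v i) (sub_mem hn (Submodule.smul_mem _ r (hv i)))
          (by simp [hr, hva]) (sub_mem hn.1 (Submodule.smul_mem _ r (hv i).1))
        have h2 : b ⟨i, hai⟩ ∈ Submodule.span R (Set.range b) := Submodule.subset_span ⟨_, rfl⟩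
        have := add_mem h1 (Submodule.smul_mem _ r h2)
        convert this using 1
        ext1
        simp [b]
  refine Module.Free.of_basis (Module.Basis.mk (LinearIndependent.of_comp N.subtype (v := b) indep) ?_)
  rintro ⟨n, hn⟩ -
  by_cases h : n = 0
  · subst h; exact Submodule.zero_mem _
  obtain ⟨j, hj, hmax⟩ := n.support.exists_max_image id (Finsupp.support_nonempty_iff.2 h)
  exact span j n ⟨hn, fun k hk => by
    by_contra hk'
    exact absurd (hmax k (Finsupp.mem_support_iff.2 hk')) (not_le.2 hk)⟩

/-- A submodule of a free module over a principal ideal domain is free. -/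
theorem Submodule.free_of_isPrincipalIdealRing {R M : Type*} [CommRing R] [IsDomain R]
    [IsPrincipalIdealRing R] [AddCommGroup M] [Module R M] [Module.Free R M] (N : Submodule R M) :
    Module.Free R N := by
  let e := (Module.Free.chooseBasis R M).repr
  have := Finsupp.free_submodule_of_isPrincipalIdealRing (N.map e.toLinearMap)
  exact Module.Free.of_equiv (e.submoduleMap N).symm

/-- Over a principal ideal domain, the kernel of a linear map to a free module is a retract. -/
theorem LinearMap.exists_ker_retraction [IsDomain R] [IsPrincipalIdealRing R] {C D : Type*}
    [AddCommGroup C] [Module R C] [AddCommGroup D] [Module R D] [Module.Free R D]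
    (d : C →ₗ[R] D) :
    ∃ p : C →ₗ[R] LinearMap.ker d, ∀ z : LinearMap.ker d, p z = z := by
  have := Submodule.free_of_isPrincipalIdealRing (LinearMap.range d)
  -- The range of `d` is free, so `d` has a section `s` over its range, and `id - s ∘ d` is the
  -- retraction.
  obtain ⟨s, hs⟩ := Module.projective_lifting_property d.rangeRestrict LinearMap.id
    d.surjective_rangeRestrict
  have hs' : ∀ c, d (s (d.rangeRestrict c)) = d c := fun c =>
    congrArg Subtype.val (LinearMap.congr_fun hs (d.rangeRestrict c))
  have h : ∀ c, (LinearMap.id - s ∘ₗ d.rangeRestrict : C →ₗ[R] C) c ∈ LinearMap.ker d := fun c => by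
    simp only [LinearMap.mem_ker, LinearMap.sub_apply, map_sub]
    exact sub_eq_zero.2 (hs' c).symm
  refine ⟨LinearMap.codRestrict _ _ h, fun z => Subtype.ext ?_⟩
  have : d.rangeRestrict z = 0 := Subtype.ext z.2
  simp [this]

/-- An order on a basis of `M` yields a basis of the exterior algebra, which is therefore free. This
flatness is what makes torsion in the homology of a tensor product invisible to labels. -/
instance ExteriorAlgebra.flat_of_free {M : Type*} [AddCommGroup M] [Module R M] [Module.Free R M] :
    Module.Flat R (ExteriorAlgebra R M) := by
  classical
  let _ : LinearOrder (Module.Free.ChooseBasisIndex R M) := linearOrderOfSTO WellOrderingRel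
  have := Module.Free.of_basis (Module.Free.chooseBasis R M).ExteriorAlgebra
  infer_instance

end LinearAlgebra

/-! ### The chain complex as a single module, with boundary and sign operators -/

namespace PrecubicalSet

universe u v

open TensorProduct DirectSum

section TotalComplex

variable (P : PrecubicalSet.{u}) (R : Type v) [CommRing R]

instance (n : ℕ) : Module.Free R (P.Chain R n) := Module.Free.of_basis (P.cubeBasis R n)

theorem boundary_cube {n : ℕ} (x : P.cube (n + 1)) :
    P.boundary R n (P.cubeBasis R (n + 1) x) = ∑ i : Fin (n + 1), (-1 : R) ^ (i.1 + 1) •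
      (P.cubeBasis R n (P.face 0 i x) - P.cubeBasis R n (P.face 1 i x)) :=
  Module.Basis.constr_basis ..

/-- Over a principal ideal domain, the cycles are a retract of the chains. -/
theorem exists_cycles_retraction [IsDomain R] [IsPrincipalIdealRing R] (n : ℕ) :
    ∃ p : P.Chain R n →ₗ[R] P.cycles R n, ∀ z : P.cycles R n, p z = z := by
  cases n with
  | zero => exact ⟨LinearMap.id.codRestrict ⊤ fun _ => trivial, fun _ => rfl⟩
  | succ n => exact (P.boundary R n).exists_ker_retraction

theorem boundary_mem_cycles (n : ℕ) (z : P.Chain R (n + 1)) : P.boundary R n z ∈ P.cycles R n := by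
  cases n with
  | zero => trivial
  | succ n => exact P.boundary_boundary R n z

/-- The module of chains of all degrees. -/
abbrev TotalChain : Type (max u v) := ⨁ n, P.Chain R n

/-- The boundary operator in degree `n`, with values in the module of all chains. -/
noncomputable def toTotalBoundary : ∀ n, P.Chain R n →ₗ[R] P.TotalChain R
  | 0 => 0
  | n + 1 => lof R ℕ (P.Chain R) n ∘ₗ P.boundary R n

/-- The boundary operator on the module of all chains. -/
noncomputable def totalBoundary : P.TotalChain R →ₗ[R] P.TotalChain R :=
  toModule R ℕ _ (P.toTotalBoundary R)

/-- The operator that multiplies the chains of degree `n` with `(-1)^n`. -/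
noncomputable def sign : P.TotalChain R →ₗ[R] P.TotalChain R :=
  toModule R ℕ _ fun n => (-1 : R) ^ n • lof R ℕ (P.Chain R) n

@[simp] theorem totalBoundary_zero (z : P.Chain R 0) :
    P.totalBoundary R (lof R ℕ (P.Chain R) 0 z) = 0 := by
  simp [totalBoundary, toTotalBoundary]

@[simp] theorem totalBoundary_succ (n : ℕ) (z : P.Chain R (n + 1)) :
    P.totalBoundary R (lof R ℕ (P.Chain R) (n + 1) z) =
      lof R ℕ (P.Chain R) n (P.boundary R n z) := by
  simp [totalBoundary, toTotalBoundary]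

@[simp] theorem sign_lof (n : ℕ) (z : P.Chain R n) :
    P.sign R (lof R ℕ (P.Chain R) n z) = (-1 : R) ^ n • lof R ℕ (P.Chain R) n z := by
  simp [sign]

theorem lof_mem_ker_totalBoundary {n : ℕ} {z : P.Chain R n} :
    P.totalBoundary R (lof R ℕ (P.Chain R) n z) = 0 ↔ z ∈ P.cycles R n := by
  cases n with
  | zero => simp [cycles]
  | succ n =>
    rw [totalBoundary_succ, cycles, LinearMap.mem_ker]
    exact (map_eq_zero_iff _ (DirectSum.of_injective (β := P.Chain R) n))

theorem component_totalBoundary (n : ℕ) (z : P.TotalChain R) :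
    component R ℕ (P.Chain R) n (P.totalBoundary R z) =
      P.boundary R n (component R ℕ (P.Chain R) (n + 1) z) := by
  refine LinearMap.congr_fun (f := component R ℕ (P.Chain R) n ∘ₗ P.totalBoundary R)
    (g := P.boundary R n ∘ₗ component R ℕ (P.Chain R) (n + 1)) ?_ z
  refine DirectSum.linearMap_ext R fun m => LinearMap.ext fun y => ?_
  cases m with
  | zero => simp [component.of]
  | succ m =>
    by_cases h : m = n
    · subst h
      simp [component.lof_self]
    · simp [component.of, h]

/-- The total boundary is homogeneous, so an inhomogeneous cycle is a sum of homogeneous ones, and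
statements about the kernel of `totalBoundary` reduce to single degrees. -/
theorem component_mem_cycles {z : P.TotalChain R} (hz : P.totalBoundary R z = 0) (n : ℕ) :
    component R ℕ (P.Chain R) n z ∈ P.cycles R n := by
  cases n with
  | zero => trivial
  | succ n =>
    rw [cycles, LinearMap.mem_ker, ← component_totalBoundary, hz, map_zero]

theorem sign_sign (z : P.TotalChain R) : P.sign R (P.sign R z) = z := by
  refine LinearMap.congr_fun (f := P.sign R ∘ₗ P.sign R) (g := LinearMap.id) ?_ z
  refine DirectSum.linearMap_ext R fun m => LinearMap.ext fun y => ?_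
  simp [smul_smul, ← mul_pow]

/-- The boundary lowers the degree by one, so it anticommutes with the degree sign. -/
theorem sign_totalBoundary (z : P.TotalChain R) :
    P.sign R (P.totalBoundary R z) = - P.totalBoundary R (P.sign R z) := by
  refine LinearMap.congr_fun (f := P.sign R ∘ₗ P.totalBoundary R)
    (g := - (P.totalBoundary R ∘ₗ P.sign R)) ?_ z
  refine DirectSum.linearMap_ext R fun m => LinearMap.ext fun y => ?_
  cases m with
  | zero => simp
  | succ m => simp [pow_succ]

end TotalComplex

/-! ### Chains of a tensor product inside the tensor product of the chain complexes -/

section Tensor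

variable (P : PrecubicalSet.{u₁}) (Q : PrecubicalSet.{u₂}) (R : Type v) [CommRing R]

/-- The boundary operator of the tensor product of two chain complexes. -/
noncomputable def tensorBoundary :
    P.TotalChain R ⊗[R] Q.TotalChain R →ₗ[R] P.TotalChain R ⊗[R] Q.TotalChain R :=
  (P.totalBoundary R).rTensor _ + TensorProduct.map (P.sign R) (Q.totalBoundary R)

/-- The chains of `P ⊗ Q` as elements of the tensor product of the chain complexes. -/
noncomputable def tensorChain (n : ℕ) :
    (P.tensor Q).Chain R n →ₗ[R] P.TotalChain R ⊗[R] Q.TotalChain R :=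
  ((P.tensor Q).cubeBasis R n).constr R fun c : TensorCube P Q n =>
    lof R ℕ (P.Chain R) c.p (P.cubeBasis R c.p c.fst) ⊗ₜ[R]
      lof R ℕ (Q.Chain R) c.q (Q.cubeBasis R c.q c.snd)

theorem tensorChain_cube {n : ℕ} (c : TensorCube P Q n) :
    tensorChain P Q R n ((P.tensor Q).cubeBasis R n c) =
      lof R ℕ (P.Chain R) c.p (P.cubeBasis R c.p c.fst) ⊗ₜ[R]
        lof R ℕ (Q.Chain R) c.q (Q.cubeBasis R c.q c.snd) :=
  Module.Basis.constr_basis ..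

theorem tensorChain_boundary_cube {n : ℕ} (c : TensorCube P Q (n + 1)) :
    tensorChain P Q R n ((P.tensor Q).boundary R n ((P.tensor Q).cubeBasis R (n + 1) c)) =
      ∑ i : Fin (n + 1), (-1 : R) ^ (i.1 + 1) •
        (lof R ℕ (P.Chain R) (c.face 0 i).p (P.cubeBasis R _ (c.face 0 i).fst) ⊗ₜ[R]
            lof R ℕ (Q.Chain R) (c.face 0 i).q (Q.cubeBasis R _ (c.face 0 i).snd) -
          lof R ℕ (P.Chain R) (c.face 1 i).p (P.cubeBasis R _ (c.face 1 i).fst) ⊗ₜ[R]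
            lof R ℕ (Q.Chain R) (c.face 1 i).q (Q.cubeBasis R _ (c.face 1 i).snd)) := by
  refine (congrArg _ (boundary_cube ..)).trans ?_
  rw [map_sum]
  refine Finset.sum_congr rfl fun i _ => ?_
  rw [map_smul, map_sub]
  congr 2 <;> exact tensorChain_cube ..

/-- On a cube `(x, y)` the first `p` faces act on `x` and give `dx ⊗ y`. The indices of the others
are shifted by `p`, and this shift produces the sign `(-1)^p` in front of `x ⊗ dy`. The cases in
which `x` or `y` is a vertex are separate because one of the two groups of faces is then empty. -/
theorem tensorChain_boundary (n : ℕ) (z : (P.tensor Q).Chain R (n + 1)) :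
    tensorChain P Q R n ((P.tensor Q).boundary R n z) =
      tensorBoundary P Q R (tensorChain P Q R (n + 1) z) := by
  refine LinearMap.congr_fun (f := tensorChain P Q R n ∘ₗ (P.tensor Q).boundary R n)
    (g := tensorBoundary P Q R ∘ₗ tensorChain P Q R (n + 1)) ?_ z
  refine ((P.tensor Q).cubeBasis R (n + 1)).ext ?_
  rintro ⟨p, q, h, x, y⟩
  simp only [LinearMap.comp_apply, tensorChain_cube, tensorChain_boundary_cube,
    tensorBoundary, LinearMap.add_apply, LinearMap.rTensor_tmul, TensorProduct.map_tmul]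
  cases p with
  | zero =>
    obtain rfl : q = n + 1 := by omega
    simp only [totalBoundary_zero, zero_tmul, zero_add, sign_lof, pow_zero, one_smul,
      totalBoundary_succ, boundary_cube, map_sum, map_smul, map_sub, tmul_sum, tmul_smul, tmul_sub]
    refine Finset.sum_congr rfl fun i _ => ?_
    rw [TensorCube.face_right (hi := Nat.zero_le _), TensorCube.face_right (hi := Nat.zero_le _)]
    rfl
  | succ p =>
    cases q with
    | zero =>
      obtain rfl : p = n := by omega
      simp only [totalBoundary_zero, tmul_zero, add_zero, totalBoundary_succ, boundary_cube,
        map_sum, map_smul, map_sub, sum_tmul, ← smul_tmul', sub_tmul]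
      refine Finset.sum_congr rfl fun i _ => ?_
      rw [TensorCube.face_left (hi := i.2), TensorCube.face_left (hi := i.2)]
    | succ q =>
      obtain rfl : n = p + 1 + q := by omega
      -- The `p + 1 + (q + 1)` faces are split into those of `x` and those of `y`.
      refine (Fin.sum_univ_add (a := p + 1) (b := q + 1) _).trans ?_
      simp only [totalBoundary_succ, boundary_cube, sign_lof,
        map_sum, map_smul, map_sub, sum_tmul, ← smul_tmul', sub_tmul, tmul_sum, tmul_smul, tmul_sub]
      congr 1
      · refine Finset.sum_congr rfl fun i _ => ?_
        have hi : (Fin.castAdd (q + 1) i).1 < p + 1 := i.2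
        rw [TensorCube.face_left (h := h) (hi := hi), TensorCube.face_left (h := h) (hi := hi)]
        rfl
      · refine Finset.sum_congr rfl fun i _ => ?_
        have hi : p + 1 ≤ (Fin.natAdd (p + 1) i).1 := Nat.le_add_right _ _
        rw [TensorCube.face_right (h := h) (hi := hi), TensorCube.face_right (h := h) (hi := hi)]
        have e : ∀ hi', (⟨p + 1 + i.1 - (p + 1), hi'⟩ : Fin (q + 1)) = i := fun _ =>
          Fin.ext (by simp)
        simp only [Fin.val_natAdd, e, smul_smul, smul_sub, ← pow_add]
        ring_nf

/-- The cross product of chains. -/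
noncomputable def cross {p q n : ℕ} (h : p + q = n) :
    P.Chain R p →ₗ[R] Q.Chain R q →ₗ[R] (P.tensor Q).Chain R n :=
  (P.cubeBasis R p).constr R fun x => (Q.cubeBasis R q).constr R fun y =>
    (P.tensor Q).cubeBasis R n (⟨p, q, h, x, y⟩ : TensorCube P Q n)

theorem cross_cube {p q n : ℕ} (h : p + q = n) (x : P.cube p) (y : Q.cube q) :
    cross P Q R h (P.cubeBasis R p x) (Q.cubeBasis R q y) =
      (P.tensor Q).cubeBasis R n (⟨p, q, h, x, y⟩ : TensorCube P Q n) := by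
  simp [cross, Module.Basis.constr_basis]

theorem tensorChain_cross {p q n : ℕ} (h : p + q = n) (z : P.Chain R p) (z' : Q.Chain R q) :
    tensorChain P Q R n (cross P Q R h z z') =
      lof R ℕ (P.Chain R) p z ⊗ₜ[R] lof R ℕ (Q.Chain R) q z' := by
  refine LinearMap.congr_fun₂ (f := (cross P Q R h).compr₂ (tensorChain P Q R n))
    (g := (TensorProduct.mk R _ _).compl₁₂ (lof R ℕ (P.Chain R) p) (lof R ℕ (Q.Chain R) q)) ?_ z z'
  refine (P.cubeBasis R p).ext fun x => (Q.cubeBasis R q).ext fun y => ?_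
  simp [cross_cube, tensorChain_cube]

/-- A left inverse applies the cross product to the components of bidegree `(p, q)` with `p + q = n`
and discards the others. -/
theorem tensorChain_injective (n : ℕ) : Function.Injective (tensorChain P Q R n) := by
  let K : P.TotalChain R ⊗[R] Q.TotalChain R →ₗ[R] (P.tensor Q).Chain R n :=
    TensorProduct.lift (toModule R ℕ _ fun p => LinearMap.flip (toModule R ℕ _ fun q =>
      LinearMap.flip (if h : p + q = n then cross P Q R h else 0)))
  have hK : K ∘ₗ tensorChain P Q R n = LinearMap.id := by
    refine ((P.tensor Q).cubeBasis R n).ext ?_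
    rintro ⟨p, q, h, x, y⟩
    simp [K, tensorChain_cube, h, cross_cube]
  exact (show Function.LeftInverse K _ from LinearMap.congr_fun hK).injective

/-- By injectivity of `tensorChain`, being a cycle can be tested in the algebraic tensor product; in
degree `0` both sides hold for every chain. -/
theorem tensorBoundary_tensorChain {n : ℕ} {z : (P.tensor Q).Chain R n} :
    tensorBoundary P Q R (tensorChain P Q R n z) = 0 ↔ z ∈ (P.tensor Q).cycles R n := by
  cases n with
  | zero =>
    refine iff_of_true ?_ trivial
    refine LinearMap.congr_fun (f := tensorBoundary P Q R ∘ₗ tensorChain P Q R 0) (g := 0) ?_ z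
    refine ((P.tensor Q).cubeBasis R 0).ext ?_
    rintro ⟨p, q, h, x, y⟩
    obtain ⟨rfl, rfl⟩ : p = 0 ∧ q = 0 := by omega
    simp [tensorBoundary, tensorChain_cube]
  | succ n =>
    rw [← tensorChain_boundary, cycles, LinearMap.mem_ker,
      map_eq_zero_iff _ (tensorChain_injective P Q R n)]

theorem cross_mem_cycles {p q n : ℕ} (h : p + q = n) {z : P.Chain R p} (hz : z ∈ P.cycles R p)
    {z' : Q.Chain R q} (hz' : z' ∈ Q.cycles R q) :
    cross P Q R h z z' ∈ (P.tensor Q).cycles R n := by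
  rw [← tensorBoundary_tensorChain, tensorChain_cross]
  simp [tensorBoundary, (P.lof_mem_ker_totalBoundary R).2 hz,
    (Q.lof_mem_ker_totalBoundary R).2 hz']

/-- `(d ⊗ 1) w` is in the range of `1 ⊗ d` for a cycle `w`. -/
theorem rTensor_mem_range {w : P.TotalChain R ⊗[R] Q.TotalChain R}
    (hw : tensorBoundary P Q R w = 0) :
    (P.totalBoundary R).rTensor _ w ∈ LinearMap.range ((Q.totalBoundary R).lTensor
      (P.TotalChain R)) := by
  -- The cycle condition reads `(d ⊗ 1) w = -(sign ⊗ d) w = (1 ⊗ d) (-(sign ⊗ 1) w)`.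
  refine ⟨-(P.sign R).rTensor _ w, ?_⟩
  rw [map_neg, ← LinearMap.comp_apply, LinearMap.lTensor_comp_rTensor]
  exact neg_eq_of_add_eq_zero_left hw

/-- `(1 ⊗ d) w` is in the range of `d ⊗ 1` for a cycle `w`. -/
theorem lTensor_mem_range {w : P.TotalChain R ⊗[R] Q.TotalChain R}
    (hw : tensorBoundary P Q R w = 0) :
    (Q.totalBoundary R).lTensor _ w ∈ LinearMap.range ((P.totalBoundary R).rTensor
      (Q.TotalChain R)) := by
  refine ⟨(P.sign R).rTensor _ w, ?_⟩
  -- Applying `sign ⊗ 1` to the cycle condition removes the sign from the second term and, by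
  -- anticommutation, puts it inside the boundary in the first.
  have h : (P.sign R).rTensor _ ∘ₗ tensorBoundary P Q R =
      (Q.totalBoundary R).lTensor _ - (P.totalBoundary R).rTensor _ ∘ₗ (P.sign R).rTensor _ := by
    refine TensorProduct.ext' fun x y => ?_
    simp [tensorBoundary, sign_sign, sign_totalBoundary, neg_tmul, sub_eq_neg_add]
  have h := LinearMap.congr_fun h w
  rw [LinearMap.comp_apply, hw, map_zero, LinearMap.sub_apply, LinearMap.comp_apply] at h
  exact (sub_eq_zero.1 h.symm).symm

end Tensor

end PrecubicalSet

/-! ## The homology language of a tensor product -/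

section WordVector

variable {L L' : Type*} (R : Type*) [CommRing R]

/-- The sum of the letters of a word. -/
noncomputable def FreeMonoid.letterSum (u : FreeMonoid L) : L →₀ R :=
  ∑ j : Fin u.toList.length, Finsupp.single (u.toList.get j) 1

theorem FreeMonoid.letterSum_eq (u : FreeMonoid L) :
    u.letterSum R = (u.toList.map fun a => Finsupp.single a (1 : R)).sum := by
  rw [letterSum, ← List.sum_ofFn, ← Function.comp_def (fun a => Finsupp.single a (1 : R)),
    ← List.map_ofFn, List.ofFn_get]

theorem FreeMonoid.letterSum_map (φ : L → L') (u : FreeMonoid L) :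
    (FreeMonoid.map φ u).letterSum R = Finsupp.lmapDomain R R φ (u.letterSum R) := by
  rw [letterSum_eq, letterSum_eq, map_list_sum, FreeMonoid.toList_map, List.map_map, List.map_map]
  congr 2
  funext a
  simp

end WordVector

namespace PrecubicalSet

variable {P : PrecubicalSet.{u₁}} {Q : PrecubicalSet.{u₂}}

theorem startEdge_last (n : ℕ) (x : P.cube (n + 2)) :
    P.startEdge x (Fin.last (n + 1)) =
      P.startEdge (P.face 0 (Fin.last n).castSucc x) (Fin.last n) := by
  rw [startEdge, dif_pos rfl]

theorem startEdge_castSucc (n : ℕ) (x : P.cube (n + 2)) (i : Fin (n + 1)) :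
    P.startEdge x i.castSucc = P.startEdge (P.face 0 (Fin.last (n + 1)) x) i := by
  rw [startEdge, dif_neg (Fin.castSucc_ne_last i), Fin.castPred_castSucc]

end PrecubicalSet

namespace ConcurrentAlphabet

variable {S : ConcurrentAlphabet.{w₁}} {T : ConcurrentAlphabet.{w₂}}

/-- The letters of the first factor of a tensor product. -/
def tensorInl (a : S.Letter) : (S.tensor T).Letter := Sum.inl a

/-- The letters of the second factor of a tensor product. -/
def tensorInr (b : T.Letter) : (S.tensor T).Letter := Sum.inr b

/-- The letters of the first summand of a coproduct. -/
def coprodInl (a : S.Letter) : (S.coprod T).Letter := Sum.inl a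

/-- The letters of the second summand of a coproduct. -/
def coprodInr (b : T.Letter) : (S.coprod T).Letter := Sum.inr b

end ConcurrentAlphabet

namespace HDA

universe u v w

open PrecubicalSet TensorProduct DirectSum

/-- Induction along the recursion of `startEdge`, which removes one of the last two directions.
While `q > 0` and `i` is not last, the removed direction belongs to `y`, so `x` is unchanged; once
`q = 0`, the recursion is that of `x`. -/
theorem pairLabel_startEdge_left (A : HDA.{u₁, w₁}) (B : HDA.{u₂, w₂}) {n : ℕ} :
    ∀ {p q : ℕ} (h : p + q = n) (x : A.P.cube p) (y : B.P.cube q) (i : Fin n) (hi : i.1 < p),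
    pairLabel A B ((A.P.tensor B.P).startEdge (⟨p, q, h, x, y⟩ : TensorCube A.P B.P n) i) =
      FreeMonoid.map Sum.inl (A.label (A.P.startEdge x ⟨i.1, hi⟩)) := by
  induction n with
  | zero => intro p q h x y i; exact i.elim0
  | succ n ih =>
    cases n with
    | zero =>
      intro p q h x y i hi
      obtain ⟨rfl, rfl⟩ : p = 1 ∧ q = 0 := by have := i.2; omega
      rfl
    | succ n =>
      intro p q h x y i hi
      induction i using Fin.lastCases with
      | last =>
        have hi : n + 1 < p := hi
        obtain ⟨rfl, rfl⟩ : p = n + 2 ∧ q = 0 := by omega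
        have e' := startEdge_last (P := A.P.tensor B.P) n (⟨n + 2, 0, h, x, y⟩ : TensorCube A.P B.P _)
        have e : (A.P.tensor B.P).face 0 (Fin.last n).castSucc
            (⟨n + 2, 0, h, x, y⟩ : TensorCube A.P B.P (n + 2)) =
            (⟨n + 1, 0, rfl, A.P.face 0 (Fin.last n).castSucc x, y⟩ : TensorCube A.P B.P _) :=
          TensorCube.face_left (hi := (Fin.last n).castSucc.2) ..
        rw [e', e, ih (p := n + 1) (q := 0) rfl _ y (Fin.last n) (Fin.last n).2]
        exact congrArg (fun z => FreeMonoid.map Sum.inl (A.label z)) (startEdge_last n x).symm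
      | cast i =>
        have e' := startEdge_castSucc (P := A.P.tensor B.P) n
          (⟨p, q, h, x, y⟩ : TensorCube A.P B.P _) i
        cases q with
        | zero =>
          obtain rfl : p = n + 2 := by omega
          have e : (A.P.tensor B.P).face 0 (Fin.last (n + 1))
              (⟨n + 2, 0, h, x, y⟩ : TensorCube A.P B.P (n + 2)) =
              (⟨n + 1, 0, rfl, A.P.face 0 (Fin.last (n + 1)) x, y⟩ : TensorCube A.P B.P _) :=
            TensorCube.face_left (hi := (Fin.last (n + 1)).2) ..
          rw [e', e, ih (p := n + 1) (q := 0) rfl _ y i i.2]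
          exact congrArg (fun z => FreeMonoid.map Sum.inl (A.label z)) (startEdge_castSucc n x i).symm
        | succ q =>
          have hp : p ≤ (Fin.last (n + 1)).1 := by simp only [Fin.val_last]; omega
          have e : (A.P.tensor B.P).face 0 (Fin.last (n + 1))
              (⟨p, q + 1, h, x, y⟩ : TensorCube A.P B.P (n + 2)) = _ :=
            TensorCube.face_right (hi := hp) ..
          rw [e', e, ih]
          rfl

theorem pairLabel_startEdge_right (A : HDA.{u₁, w₁}) (B : HDA.{u₂, w₂}) {n : ℕ} :
    ∀ {p q : ℕ} (h : p + q = n) (x : A.P.cube p) (y : B.P.cube q) (i : Fin n) (j : Fin q)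
      (_ : p + j.1 = i.1),
    pairLabel A B ((A.P.tensor B.P).startEdge (⟨p, q, h, x, y⟩ : TensorCube A.P B.P n) i) =
      FreeMonoid.map Sum.inr (B.label (B.P.startEdge y j)) := by
  induction n with
  | zero => intro p q h x y i; exact i.elim0
  | succ n ih =>
    cases n with
    | zero =>
      intro p q h x y i j hi
      obtain ⟨rfl, rfl⟩ : p = 0 ∧ q = 1 := by have := j.2; omega
      rfl
    | succ n =>
      intro p q h x y i j hi
      induction i using Fin.lastCases with
      | last =>
        have hi : p + j.1 = n + 1 := hi
        have e' := startEdge_last (P := A.P.tensor B.P) n (⟨p, q, h, x, y⟩ : TensorCube A.P B.P _)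
        cases q with
        | zero => exact j.elim0
        | succ q =>
          obtain rfl : j = Fin.last q := Fin.ext (by have := j.2; simp only [Fin.val_last]; omega)
          cases q with
          | zero =>
            -- Here `y` is an edge, so the removed penultimate direction belongs to `x`, and `y`
            -- stays as it is.
            obtain rfl : p = n + 1 := by omega
            have e : (A.P.tensor B.P).face 0 (Fin.last n).castSucc
                (⟨n + 1, 1, h, x, y⟩ : TensorCube A.P B.P (n + 2)) = _ :=
              TensorCube.face_left (n := n + 1) (hi := show n < n + 1 by omega) ..
            rw [e', e, ih (p := n) (q := 1) rfl _ y (Fin.last n) 0 rfl]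
            rfl
          | succ q =>
            have hp : p ≤ (Fin.last n).castSucc.1 := by simp; omega
            have e : (A.P.tensor B.P).face 0 (Fin.last n).castSucc
                (⟨p, q + 2, h, x, y⟩ : TensorCube A.P B.P (n + 2)) = _ :=
              TensorCube.face_right (hi := hp) ..
            rw [e', e, ih _ _ _ _ (Fin.last q) (by simp; omega), startEdge_last]
            congr 5
            simp only [Fin.val_last, Fin.val_castSucc] at *; omega
      | cast i =>
        have hi : p + j.1 = i.1 := hi
        have e' := startEdge_castSucc (P := A.P.tensor B.P) n
          (⟨p, q, h, x, y⟩ : TensorCube A.P B.P _) i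
        have := i.2
        -- As `i = p + j` is not the last direction, `j` is not the last direction of `y`, which
        -- forces `q ≥ 2`.
        obtain ⟨q, rfl⟩ : ∃ q', q = q' + 2 := ⟨q - 2, by have := j.2; omega⟩
        have hj : j.1 < q + 1 := by omega
        obtain ⟨j, rfl⟩ : ∃ j' : Fin (q + 1), j = j'.castSucc := ⟨⟨j.1, hj⟩, rfl⟩
        have hp : p ≤ (Fin.last (n + 1)).1 := by simp only [Fin.val_last]; omega
        have e : (A.P.tensor B.P).face 0 (Fin.last (n + 1))
            (⟨p, q + 2, h, x, y⟩ : TensorCube A.P B.P (n + 2)) = _ :=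
          TensorCube.face_right (hi := hp) ..
        rw [e', e, ih _ _ _ _ j hi, startEdge_castSucc]
        congr 5
        simp only [Fin.val_last, Fin.val_castSucc] at *; omega

section HomologyLanguage

variable (R : Type v) [CommRing R]

/-- Multilinearity of the wedge product turns the sum over all choices of positions into one product
of letter sums. In this form labels are compatible with algebra homomorphisms and with concatenation
of lists. -/
theorem wordWedge_eq (S : ConcurrentAlphabet.{w}) {n : ℕ} (m : Fin n → FreeMonoid S.Letter) :
    wordWedge R S m = (List.ofFn fun i => ExteriorAlgebra.ι R ((m i).letterSum R)).prod := by
  rw [← ExteriorAlgebra.ιMulti_apply]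
  exact ((ExteriorAlgebra.ιMulti R n).toMultilinearMap.map_sum
    fun i (j : Fin (m i).toList.length) => Finsupp.single ((m i).toList.get j) (1 : R)).symm

theorem labeling_cube (A : HDA.{u, w}) {n : ℕ} (x : A.P.cube n) :
    labeling R A n (A.P.cubeBasis R n x) =
      (List.ofFn fun i => ExteriorAlgebra.ι R ((A.label (A.P.startEdge x i)).letterSum R)).prod := by
  rw [← wordWedge_eq]
  exact Module.Basis.constr_basis ..

/-- Classes are represented by cycles, so all later arguments can work with cycles and never with
the quotient. -/
theorem mem_homologyLanguage {A : HDA.{u, w}} {n : ℕ} {a : Ext R A.alph} :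
    a ∈ homologyLanguage R A n ↔ ∃ z ∈ A.P.cycles R n, labeling R A n z = a := by
  constructor
  · rintro ⟨z, rfl⟩
    obtain ⟨z, rfl⟩ := Submodule.mkQ_surjective _ z
    exact ⟨z.1, z.2, rfl⟩
  · rintro ⟨z, hz, rfl⟩
    exact ⟨Submodule.mkQ _ ⟨z, hz⟩, rfl⟩

/-- The homomorphism of exterior algebras that is induced by a map of letters. -/
noncomputable def mapExt {S : ConcurrentAlphabet.{w₁}} {T : ConcurrentAlphabet.{w₂}}
    (φ : S.Letter → T.Letter) : Ext R S →ₐ[R] Ext R T :=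
  ExteriorAlgebra.map (Finsupp.lmapDomain R R φ)

theorem mapExt_prod {S : ConcurrentAlphabet.{w₁}} {T : ConcurrentAlphabet.{w₂}}
    (φ : S.Letter → T.Letter) {n : ℕ} (m : Fin n → FreeMonoid S.Letter) :
    mapExt R φ (List.ofFn fun i => ExteriorAlgebra.ι R ((m i).letterSum R)).prod =
      (List.ofFn fun i => ExteriorAlgebra.ι R ((FreeMonoid.map φ (m i)).letterSum R)).prod := by
  rw [map_list_prod, List.map_ofFn]
  congr 2
  funext i
  rw [FreeMonoid.letterSum_map]
  exact ExteriorAlgebra.map_apply_ι ..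

/-- The starting edges of `(x, y)` are those of `x` followed by those of `y`, so the product of the
letter sums splits after the first `p` factors. -/
theorem labeling_tensor_cube (A : HDA.{u₁, w₁}) (B : HDA.{u₂, w₂}) {n : ℕ}
    (c : TensorCube A.P B.P n) :
    labeling R (A.tensor B) n ((A.tensor B).P.cubeBasis R n c) =
      mapExt R (ConcurrentAlphabet.tensorInl (T := B.alph)) (labeling R A c.p (A.P.cubeBasis R c.p c.fst)) *
      mapExt R (ConcurrentAlphabet.tensorInr (S := A.alph))
        (labeling R B c.q (B.P.cubeBasis R c.q c.snd)) := by
  obtain ⟨p, q, rfl, x, y⟩ := c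
  refine (labeling_cube R (A.tensor B) _).trans ?_
  rw [labeling_cube, labeling_cube, mapExt_prod, mapExt_prod, ← List.prod_append,
    ← List.ofFn_fin_append]
  congr 2
  funext i
  induction i using Fin.addCases with
  | left i =>
    rw [Fin.append_left]
    exact congrArg (fun u => ExteriorAlgebra.ι R (FreeMonoid.letterSum R u))
      (pairLabel_startEdge_left A B rfl x y (Fin.castAdd q i) i.2)
  | right i =>
    rw [Fin.append_right]
    exact congrArg (fun u => ExteriorAlgebra.ι R (FreeMonoid.letterSum R u))
      (pairLabel_startEdge_right A B rfl x y (Fin.natAdd p i) i rfl)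

/-- The labeling of chains of all degrees. -/
noncomputable def totalLabeling (A : HDA.{u, w}) : A.P.TotalChain R →ₗ[R] Ext R A.alph :=
  toModule R ℕ _ (labeling R A)

/-- The product of elements of two exterior algebras in the exterior algebra over the disjoint
union of the alphabets. -/
noncomputable def mulExt (S : ConcurrentAlphabet.{w₁}) (T : ConcurrentAlphabet.{w₂}) :
    Ext R S ⊗[R] Ext R T →ₗ[R] Ext R (S.tensor T) :=
  LinearMap.mul' R _ ∘ₗ TensorProduct.map (mapExt R (ConcurrentAlphabet.tensorInl (T := T))).toLinearMap
    (mapExt R (ConcurrentAlphabet.tensorInr (S := S))).toLinearMap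

theorem mulExt_tmul (S : ConcurrentAlphabet.{w₁}) (T : ConcurrentAlphabet.{w₂}) (a : Ext R S)
    (b : Ext R T) : mulExt R S T (a ⊗ₜ b) =
      mapExt R (ConcurrentAlphabet.tensorInl (T := T)) a * mapExt R (ConcurrentAlphabet.tensorInr (S := S)) b :=
  rfl

/-- The labeling of the tensor product factors through `tensorChain`, which moves the computation of
its homology language into the tensor product of the two complexes. -/
theorem labeling_tensor (A : HDA.{u₁, w₁}) (B : HDA.{u₂, w₂}) {n : ℕ}
    (z : (A.P.tensor B.P).Chain R n) :
    labeling R (A.tensor B) n z = mulExt R A.alph B.alph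
      (TensorProduct.map (totalLabeling R A) (totalLabeling R B)
        (tensorChain A.P B.P R n z)) := by
  refine LinearMap.congr_fun (f := labeling R (A.tensor B) n) (g := mulExt R A.alph B.alph ∘ₗ
    TensorProduct.map (totalLabeling R A) (totalLabeling R B) ∘ₗ tensorChain A.P B.P R n) ?_ z
  refine ((A.P.tensor B.P).cubeBasis R n).ext fun c => ?_
  refine (labeling_tensor_cube R A B c).trans ?_
  refine Eq.trans ?_ (congrArg (fun t => mulExt R A.alph B.alph
    (TensorProduct.map (totalLabeling R A) (totalLabeling R B) t))
    (tensorChain_cube A.P B.P R c).symm)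
  simp only [mulExt_tmul, map_tmul, totalLabeling, toModule_lof]
  rfl

/-- The graded submodule of products of elements of two graded submodules. -/
noncomputable def productLanguage {S : ConcurrentAlphabet.{w₁}} {T : ConcurrentAlphabet.{w₂}}
    (X : ℕ → Submodule R (Ext R S)) (Y : ℕ → Submodule R (Ext R T)) (n : ℕ) :
    Submodule R (Ext R (S.tensor T)) :=
  Submodule.span R {c | ∃ p q, p + q = n ∧ ∃ a ∈ X p, ∃ b ∈ Y q, mulExt R S T (a ⊗ₜ b) = c}

theorem productLanguage_mono {S : ConcurrentAlphabet.{w₁}} {T : ConcurrentAlphabet.{w₂}}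
    {X X' : ℕ → Submodule R (Ext R S)} {Y Y' : ℕ → Submodule R (Ext R T)}
    (hX : ∀ n, X n ≤ X' n) (hY : ∀ n, Y n ≤ Y' n) (n : ℕ) :
    productLanguage R X Y n ≤ productLanguage R X' Y' n := by
  refine Submodule.span_mono ?_
  rintro _ ⟨p, q, h, a, ha, b, hb, rfl⟩
  exact ⟨p, q, h, a, hX p ha, b, hY q hb, rfl⟩

theorem totalLabeling_comp_totalBoundary (A : HDA.{u, w}) :
    totalLabeling R A ∘ₗ A.P.totalBoundary R = 0 := by
  refine DirectSum.linearMap_ext R fun n => LinearMap.ext fun z => ?_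
  cases n with
  | zero => simp
  | succ n => simp [totalLabeling, labeling_boundary]

/-- Over a principal ideal domain, the labeling of cycles can be extended to a labeling of chains
that takes its values in the homology language. -/
theorem exists_totalLabeling_extension [IsDomain R] [IsPrincipalIdealRing R] (A : HDA.{u, w}) :
    ∃ g : A.P.TotalChain R →ₗ[R] Ext R A.alph, g ∘ₗ A.P.totalBoundary R = 0 ∧
      LinearMap.ker (A.P.totalBoundary R) ≤ LinearMap.ker (totalLabeling R A - g) ∧
      ∀ n z, g (lof R ℕ (A.P.Chain R) n z) ∈ homologyLanguage R A n := by
  choose p hp using A.P.exists_cycles_retraction R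
  -- Retract onto the cycles in every degree, then label; on cycles this is the original labeling.
  let g : A.P.TotalChain R →ₗ[R] Ext R A.alph := toModule R ℕ _ fun n =>
    labeling R A n ∘ₗ (A.P.cycles R n).subtype ∘ₗ p n
  have hg : ∀ n z, z ∈ A.P.cycles R n → g (lof R ℕ (A.P.Chain R) n z) = labeling R A n z := by
    intro n z hz
    have := hp n ⟨z, hz⟩
    simp [g, this]
  refine ⟨g, ?_, ?_, ?_⟩
  · refine DirectSum.linearMap_ext R fun n => LinearMap.ext fun z => ?_
    cases n with
    | zero => simp
    | succ n => simp [hg n _ (A.P.boundary_mem_cycles R n z), labeling_boundary]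
  · intro z hz
    have hz : A.P.totalBoundary R z = 0 := hz
    rw [LinearMap.mem_ker]
    classical
    rw [← DirectSum.sum_support_of z, map_sum]
    refine Finset.sum_eq_zero fun n _ => ?_
    have h := A.P.component_mem_cycles R hz n
    have := hg n _ h
    rw [LinearMap.sub_apply, sub_eq_zero]
    refine Eq.trans ?_ this.symm
    exact toModule_lof ..
  · intro n z
    rw [mem_homologyLanguage]
    exact ⟨p n z, (p n z).2, by simp [g]⟩

/-- A Künneth formula without torsion term: the labels of a cycle of the tensor product are
unchanged when both labelings are replaced by extensions from the cycles, and cross products of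
cycles give the converse. -/
theorem homologyLanguage_tensor [IsDomain R] [IsPrincipalIdealRing R] (A : HDA.{u₁, w₁})
    (B : HDA.{u₂, w₂}) (n : ℕ) : homologyLanguage R (A.tensor B) n =
      productLanguage R (homologyLanguage R A) (homologyLanguage R B) n := by
  apply le_antisymm
  · intro c hc
    obtain ⟨z, hz, rfl⟩ := (mem_homologyLanguage R).1 hc
    obtain ⟨g, hg, hker, hmem⟩ := exists_totalLabeling_extension R A
    obtain ⟨g', hg', hker', hmem'⟩ := exists_totalLabeling_extension R B
    have hw := (tensorBoundary_tensorChain A.P B.P R).2 hz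
    -- Replace the labeling of `A` by `g` first, using that the labeling of `B` kills boundaries;
    -- then that of `B` by `g'`, using that `g` kills boundaries.
    have h1 := TensorProduct.map_eq_zero_of_rTensor_mem_range hker
      (totalLabeling_comp_totalBoundary R B) (rTensor_mem_range A.P B.P R hw)
    have h2 := TensorProduct.map_eq_zero_of_lTensor_mem_range hker' hg
      (lTensor_mem_range A.P B.P R hw)
    rw [sub_eq_add_neg, TensorProduct.map_add_left, ← neg_one_smul R, TensorProduct.map_smul_left,
      LinearMap.add_apply, LinearMap.smul_apply, neg_one_smul, add_neg_eq_zero] at h1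
    rw [sub_eq_add_neg, TensorProduct.map_add_right, ← neg_one_smul R,
      TensorProduct.map_smul_right,
      LinearMap.add_apply, LinearMap.smul_apply, neg_one_smul, add_neg_eq_zero] at h2
    have h3 : labeling R (A.tensor B) n z = _ := labeling_tensor R A B z
    rw [h3, h1, h2]
    -- Since `g` and `g'` take values in the homology languages on all chains, it no longer matters
    -- that `z` is a cycle, and single cubes suffice.
    have key : ⊤ ≤ (productLanguage R (homologyLanguage R A) (homologyLanguage R B) n).comap
        (mulExt R A.alph B.alph ∘ₗ TensorProduct.map g g' ∘ₗ tensorChain A.P B.P R n) := by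
      rw [← ((A.P.tensor B.P).cubeBasis R n).span_eq, Submodule.span_le]
      rintro _ ⟨c, rfl⟩
      refine Submodule.subset_span ⟨c.p, c.q, c.add_eq, _, hmem c.p (A.P.cubeBasis R c.p c.fst), _,
        hmem' c.q (B.P.cubeBasis R c.q c.snd), ?_⟩
      exact congrArg (fun t => mulExt R A.alph B.alph (TensorProduct.map g g' t))
        (tensorChain_cube A.P B.P R c).symm
    exact key (Submodule.mem_top (x := z))
  · refine Submodule.span_le.2 ?_
    rintro _ ⟨p, q, h, a, ha, b, hb, rfl⟩
    obtain ⟨z, hz, rfl⟩ := (mem_homologyLanguage R).1 ha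
    obtain ⟨z', hz', rfl⟩ := (mem_homologyLanguage R).1 hb
    refine (mem_homologyLanguage R).2
      ⟨cross A.P B.P R h z z', cross_mem_cycles A.P B.P R h hz hz', ?_⟩
    refine (labeling_tensor R A B _).trans ?_
    rw [tensorChain_cross]
    simp only [map_tmul, totalLabeling, toModule_lof]
    rfl

end HomologyLanguage

end HDA

/-! ## The trace language and the fundamental monoid of a tensor product -/

namespace ConcurrentAlphabet

universe w

theorem trace_comm (S : ConcurrentAlphabet.{w}) {a b : S.Letter} (h : ¬ S.Dep a b) :
    S.trace (FreeMonoid.of a) * S.trace (FreeMonoid.of b) =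
      S.trace (FreeMonoid.of b) * S.trace (FreeMonoid.of a) :=
  PresentedMonoid.mk_eq_mk_of_rel ⟨a, b, h, rfl, rfl⟩

/-- The homomorphism of trace monoids induced by a map of letters that preserves independence. -/
def mapTrace {S : ConcurrentAlphabet.{w₁}} {T : ConcurrentAlphabet.{w₂}} (φ : S.Letter → T.Letter)
    (hφ : ∀ a b, ¬ S.Dep a b → ¬ T.Dep (φ a) (φ b)) : S.TraceMonoid →* T.TraceMonoid :=
  PresentedMonoid.lift (fun a => T.trace (FreeMonoid.of (φ a))) <| by
    rintro _ _ ⟨a, b, h, rfl, rfl⟩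
    simp only [map_mul, FreeMonoid.lift_eval_of]
    exact trace_comm T (hφ a b h)

theorem mapTrace_trace {S : ConcurrentAlphabet.{w₁}} {T : ConcurrentAlphabet.{w₂}}
    (φ : S.Letter → T.Letter) (hφ : ∀ a b, ¬ S.Dep a b → ¬ T.Dep (φ a) (φ b))
    (u : FreeMonoid S.Letter) : mapTrace φ hφ (S.trace u) = T.trace (FreeMonoid.map φ u) := by
  refine DFunLike.congr_fun (f := (mapTrace φ hφ).comp S.trace)
    (g := T.trace.comp (FreeMonoid.map φ)) ?_ u
  refine FreeMonoid.hom_eq fun a => ?_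
  rfl

variable {S : ConcurrentAlphabet.{w₁}} {T : ConcurrentAlphabet.{w₂}}

variable (S T) in
/-- The inclusion of the first factor in the trace monoid of a tensor product. -/
def tensorInlTrace : S.TraceMonoid →* (S.tensor T).TraceMonoid :=
  mapTrace tensorInl fun _ _ h => h

variable (S T) in
/-- The inclusion of the second factor in the trace monoid of a tensor product. -/
def tensorInrTrace : T.TraceMonoid →* (S.tensor T).TraceMonoid :=
  mapTrace tensorInr fun _ _ h => h

variable (S T) in
/-- The projection of the trace monoid of a tensor product onto the first factor. -/
def tensorFst : (S.tensor T).TraceMonoid →* S.TraceMonoid :=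
  PresentedMonoid.lift (Sum.elim (fun a => S.trace (FreeMonoid.of a)) fun _ => 1) <| by
    rintro _ _ ⟨a | a, b | b, h, rfl, rfl⟩
    exacts [trace_comm S h, (mul_one _).trans (one_mul _).symm,
      (one_mul _).trans (mul_one _).symm, rfl]

variable (S T) in
/-- The projection of the trace monoid of a tensor product onto the second factor. -/
def tensorSnd : (S.tensor T).TraceMonoid →* T.TraceMonoid :=
  PresentedMonoid.lift (Sum.elim (fun _ => 1) fun b => T.trace (FreeMonoid.of b)) <| by
    rintro _ _ ⟨a | a, b | b, h, rfl, rfl⟩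
    exacts [rfl, (one_mul _).trans (mul_one _).symm, (mul_one _).trans (one_mul _).symm,
      trace_comm T h]

theorem traceMonoid_hom_ext {M : Type*} [Monoid M] {f g : S.TraceMonoid →* M}
    (h : ∀ a, f (S.trace (FreeMonoid.of a)) = g (S.trace (FreeMonoid.of a))) : f = g :=
  PresentedMonoid.ext _ h

@[simp] theorem tensorFst_inl (m : S.TraceMonoid) :
    tensorFst S T (tensorInlTrace S T m) = m :=
  DFunLike.congr_fun (f := (tensorFst S T).comp (tensorInlTrace S T)) (g := MonoidHom.id _)
    (traceMonoid_hom_ext fun _ => rfl) m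

@[simp] theorem tensorFst_inr (m : T.TraceMonoid) :
    tensorFst S T (tensorInrTrace S T m) = 1 :=
  DFunLike.congr_fun (f := (tensorFst S T).comp (tensorInrTrace S T)) (g := 1)
    (traceMonoid_hom_ext fun _ => rfl) m

@[simp] theorem tensorSnd_inl (m : S.TraceMonoid) :
    tensorSnd S T (tensorInlTrace S T m) = 1 :=
  DFunLike.congr_fun (f := (tensorSnd S T).comp (tensorInlTrace S T)) (g := 1)
    (traceMonoid_hom_ext fun _ => rfl) m

@[simp] theorem tensorSnd_inr (m : T.TraceMonoid) :
    tensorSnd S T (tensorInrTrace S T m) = m :=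
  DFunLike.congr_fun (f := (tensorSnd S T).comp (tensorInrTrace S T)) (g := MonoidHom.id _)
    (traceMonoid_hom_ext fun _ => rfl) m

/-- An induction principle for trace monoids. -/
theorem trace_induction {p : S.TraceMonoid → Prop} (m : S.TraceMonoid) (one : p 1)
    (mul : ∀ a m, p m → p (S.trace (FreeMonoid.of a) * m)) : p m := by
  obtain ⟨u, rfl⟩ := PresentedMonoid.surjective_mk m
  induction u using FreeMonoid.inductionOn' with
  | one => simpa using one
  | of_mul a u ih =>
    rw [map_mul]
    exact mul a _ ih

theorem tensor_commute (m : S.TraceMonoid) (m' : T.TraceMonoid) :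
    Commute (tensorInlTrace S T m) (tensorInrTrace S T m') := by
  induction m using trace_induction with
  | one => simp
  | mul a m ih =>
    rw [map_mul]
    refine Commute.mul_left ?_ ih
    clear ih
    induction m' using trace_induction with
    | one => simp
    | mul b m' ih =>
      rw [map_mul]
      refine Commute.mul_right ?_ ih
      exact trace_comm (S.tensor T) (a := tensorInl a) (b := tensorInr b) fun h => h

/-- Letters of different factors commute, so all letters of `S` can be moved to the left: the trace
monoid is the direct product, with the two projections as coordinates. -/
theorem tensor_eq_inl_mul_inr (m : (S.tensor T).TraceMonoid) :
    m = tensorInlTrace S T (tensorFst S T m) * tensorInrTrace S T (tensorSnd S T m) := by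
  induction m using trace_induction with
  | one => simp
  | mul a m ih =>
    rw [map_mul, map_mul, map_mul, map_mul, ← mul_assoc,
      mul_assoc (tensorInlTrace S T (tensorFst S T _)), (tensor_commute _ _).eq, ← mul_assoc,
      mul_assoc, ← ih]
    congr 1
    rcases a with a | b
    · exact (mul_one _).symm
    · exact (one_mul _).symm

end ConcurrentAlphabet

/-! ### Vertices, edges and paths of a tensor product -/

namespace PrecubicalSet

variable {P : PrecubicalSet.{u₁}} {Q : PrecubicalSet.{u₂}}

/-- The vertices of a tensor product. -/
def tensorVertex (x : P.cube 0) (y : Q.cube 0) : (P.tensor Q).cube 0 :=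
  (⟨0, 0, rfl, x, y⟩ : TensorCube P Q 0)

/-- The edges of a tensor product that come from edges of the first factor. -/
def tensorEdgeLeft (x : P.cube 1) (y : Q.cube 0) : (P.tensor Q).cube 1 :=
  (⟨1, 0, rfl, x, y⟩ : TensorCube P Q 1)

/-- The edges of a tensor product that come from edges of the second factor. -/
def tensorEdgeRight (x : P.cube 0) (y : Q.cube 1) : (P.tensor Q).cube 1 :=
  (⟨0, 1, rfl, x, y⟩ : TensorCube P Q 1)

theorem tensorVertex_inj {x x' : P.cube 0} {y y' : Q.cube 0}
    (h : tensorVertex x y = tensorVertex x' y') : x = x' ∧ y = y' := by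
  cases h
  exact ⟨rfl, rfl⟩

theorem exists_eq_tensorVertex (v : (P.tensor Q).cube 0) : ∃ x y, v = tensorVertex x y := by
  obtain ⟨p, q, h, x, y⟩ := v
  obtain ⟨rfl, rfl⟩ : p = 0 ∧ q = 0 := by omega
  exact ⟨x, y, rfl⟩

theorem exists_eq_tensorEdge (e : (P.tensor Q).cube 1) :
    (∃ x y, e = tensorEdgeLeft x y) ∨ ∃ x y, e = tensorEdgeRight x y := by
  obtain ⟨p, q, h, x, y⟩ := e
  obtain ⟨rfl, rfl⟩ | ⟨rfl, rfl⟩ : (p = 1 ∧ q = 0) ∨ (p = 0 ∧ q = 1) := by omega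
  · exact Or.inl ⟨x, y, rfl⟩
  · exact Or.inr ⟨x, y, rfl⟩

theorem face_tensorEdgeLeft (k : Fin 2) (x : P.cube 1) (y : Q.cube 0) :
    (P.tensor Q).face k 0 (tensorEdgeLeft x y) = tensorVertex (P.face k 0 x) y :=
  rfl

theorem face_tensorEdgeRight (k : Fin 2) (x : P.cube 0) (y : Q.cube 1) :
    (P.tensor Q).face k 0 (tensorEdgeRight x y) = tensorVertex x (Q.face k 0 y) :=
  rfl

end PrecubicalSet

namespace HDA

universe u v w

open PrecubicalSet ConcurrentAlphabet

variable (A : HDA.{u₁, w₁}) (B : HDA.{u₂, w₂})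

/-- The trace of the label of a path. -/
def pathTrace (A : HDA.{u, w}) {v w : A.P.cube 0} (ω : A.P.Path v w) : A.alph.TraceMonoid :=
  A.alph.trace (A.pathLabel ω)

theorem pathTrace_comp (A : HDA.{u, w}) {v w z : A.P.cube 0} (ω : A.P.Path v w)
    (ν : A.P.Path w z) : A.pathTrace (ω.comp ν) = A.pathTrace ω * A.pathTrace ν := by
  rw [pathTrace, pathLabel_comp, map_mul]; rfl

theorem pathTrace_nil (A : HDA.{u, w}) (v : A.P.cube 0) : A.pathTrace (.nil v) = 1 :=
  rfl

theorem pathTrace_cons (A : HDA.{u, w}) {v w : A.P.cube 0} (x : A.P.cube 1)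
    (hx : A.P.face 0 0 x = v) (ω : A.P.Path (A.P.face 1 0 x) w) :
    A.pathTrace (.cons x hx ω) = A.alph.trace (A.label x) * A.pathTrace ω :=
  map_mul ..

/-- The trace of the label of a path in a tensor product. -/
def tensorPathTrace {v w : (A.P.tensor B.P).cube 0} (ω : (A.P.tensor B.P).Path v w) :
    (A.alph.tensor B.alph).TraceMonoid :=
  (A.tensor B).pathTrace ω

theorem pathTrace_tensorEdgeLeft (x : A.P.cube 1) (y : B.P.cube 0) {v w : (A.P.tensor B.P).cube 0}
    (h : (A.P.tensor B.P).face 0 0 (tensorEdgeLeft x y) = v)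
    (ω : (A.P.tensor B.P).Path ((A.P.tensor B.P).face 1 0 (tensorEdgeLeft x y)) w) :
    tensorPathTrace A B (.cons (tensorEdgeLeft x y) h ω) =
      tensorInlTrace A.alph B.alph (A.alph.trace (A.label x)) *
        tensorPathTrace A B ω :=
  (pathTrace_cons (A.tensor B) ..).trans (congrArg (· * tensorPathTrace A B ω)
    (mapTrace_trace tensorInl (fun _ _ h => h) (A.label x)).symm)

theorem pathTrace_tensorEdgeRight (x : A.P.cube 0) (y : B.P.cube 1)
    {v w : (A.P.tensor B.P).cube 0}
    (h : (A.P.tensor B.P).face 0 0 (tensorEdgeRight x y) = v)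
    (ω : (A.P.tensor B.P).Path ((A.P.tensor B.P).face 1 0 (tensorEdgeRight x y)) w) :
    tensorPathTrace A B (.cons (tensorEdgeRight x y) h ω) =
      tensorInrTrace A.alph B.alph (B.alph.trace (B.label y)) *
        tensorPathTrace A B ω :=
  (pathTrace_cons (A.tensor B) ..).trans (congrArg (· * tensorPathTrace A B ω)
    (mapTrace_trace tensorInr (fun _ _ h => h) (B.label y)).symm)

/-- Paths in a tensor product are shuffles of paths in the factors. -/
theorem exists_paths_of_tensor {v w : (A.P.tensor B.P).cube 0} (ω : (A.P.tensor B.P).Path v w) :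
    ∀ x y, v = tensorVertex x y → ∃ x' y', w = tensorVertex x' y' ∧
      ∃ (α : A.P.Path x x') (β : B.P.Path y y'), tensorPathTrace A B ω =
        tensorInlTrace A.alph B.alph (A.pathTrace α) *
          tensorInrTrace A.alph B.alph (B.pathTrace β) := by
  induction ω with
  | nil v =>
    rintro x y rfl
    refine ⟨x, y, rfl, .nil x, .nil y, ?_⟩
    rw [pathTrace_nil, pathTrace_nil, map_one, map_one, mul_one]
    rfl
  | cons e he ω ih =>
    rintro x y rfl
    obtain ⟨x₁, y₁, rfl⟩ | ⟨x₁, y₁, rfl⟩ := exists_eq_tensorEdge e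
    · obtain ⟨hx, rfl⟩ := tensorVertex_inj ((face_tensorEdgeLeft 0 x₁ y₁).symm.trans he)
      obtain ⟨x', y', rfl, α, β, h⟩ := ih _ _ (face_tensorEdgeLeft 1 x₁ y₁)
      refine ⟨x', y', rfl, .cons x₁ hx α, β, ?_⟩
      refine (pathTrace_tensorEdgeLeft ..).trans ?_
      rw [pathTrace_cons, map_mul, mul_assoc, ← h]
    · obtain ⟨rfl, hy⟩ := tensorVertex_inj ((face_tensorEdgeRight 0 x₁ y₁).symm.trans he)
      obtain ⟨x', y', rfl, α, β, h⟩ := ih _ _ (face_tensorEdgeRight 1 x₁ y₁)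
      refine ⟨x', y', rfl, α, .cons y₁ hy β, ?_⟩
      refine (pathTrace_tensorEdgeRight ..).trans ?_
      -- The trace of the new edge of `B` must pass the trace of `α` to reach that of `β`.
      rw [pathTrace_cons, map_mul, ← mul_assoc, (tensor_commute _ _).eq, mul_assoc, ← h]

theorem exists_tensor_path_left {x x' : A.P.cube 0} (α : A.P.Path x x') (y : B.P.cube 0) :
    ∃ ω : (A.P.tensor B.P).Path (tensorVertex x y) (tensorVertex x' y),
      tensorPathTrace A B ω = tensorInlTrace A.alph B.alph (A.pathTrace α) := by
  induction α with
  | nil x => exact ⟨.nil _, (map_one (tensorInlTrace A.alph B.alph)).symm⟩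
  | cons e he α ih =>
    obtain ⟨ω, hω⟩ := ih
    refine ⟨.cons (tensorEdgeLeft e y) (congrArg (tensorVertex · y) he) ω, ?_⟩
    rw [pathTrace_cons A, map_mul, ← hω]
    exact pathTrace_tensorEdgeLeft ..

theorem exists_tensor_path_right (x : A.P.cube 0) {y y' : B.P.cube 0} (β : B.P.Path y y') :
    ∃ ω : (A.P.tensor B.P).Path (tensorVertex x y) (tensorVertex x y'),
      tensorPathTrace A B ω = tensorInrTrace A.alph B.alph (B.pathTrace β) := by
  induction β with
  | nil x => exact ⟨.nil _, (map_one (tensorInrTrace A.alph B.alph)).symm⟩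
  | cons e he β ih =>
    obtain ⟨ω, hω⟩ := ih
    refine ⟨.cons (tensorEdgeRight x e) (congrArg (tensorVertex x) he) ω, ?_⟩
    rw [pathTrace_cons B, map_mul, ← hω]
    exact pathTrace_tensorEdgeRight ..

/-- Running `α` first and `β` afterwards is enough: every other shuffle has the same trace. -/
theorem exists_tensor_path {x x' : A.P.cube 0} (α : A.P.Path x x') {y y' : B.P.cube 0}
    (β : B.P.Path y y') :
    ∃ ω : (A.P.tensor B.P).Path (tensorVertex x y) (tensorVertex x' y'),
      tensorPathTrace A B ω = tensorInlTrace A.alph B.alph (A.pathTrace α) *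
        tensorInrTrace A.alph B.alph (B.pathTrace β) := by
  obtain ⟨ω, hω⟩ := exists_tensor_path_left A B α y
  obtain ⟨ν, hν⟩ := exists_tensor_path_right A B x' β
  exact ⟨ω.comp ν, (pathTrace_comp ..).trans (congrArg₂ _ hω hν)⟩

theorem accessible_tensor : (A.tensor B).Accessible ↔ A.Accessible ∧ B.Accessible := by
  constructor
  · intro h
    have key : ∀ x y, Nonempty (A.P.Path A.init x) ∧ Nonempty (B.P.Path B.init y) := by
      intro x y
      obtain ⟨ω⟩ := h (tensorVertex x y)
      obtain ⟨x', y', hw, α, β, -⟩ := exists_paths_of_tensor A B ω _ _ rfl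
      obtain ⟨rfl, rfl⟩ := tensorVertex_inj hw
      exact ⟨⟨α⟩, ⟨β⟩⟩
    -- The initial state supplies the vertex needed in the other factor.
    exact ⟨fun x => (key x B.init).1, fun y => (key A.init y).2⟩
  · rintro ⟨hA, hB⟩ v
    obtain ⟨x, y, rfl⟩ := exists_eq_tensorVertex v
    obtain ⟨α⟩ := hA x
    obtain ⟨β⟩ := hB y
    exact ⟨(exists_tensor_path A B α β).choose⟩

theorem coaccessible_tensor : (A.tensor B).Coaccessible ↔ A.Coaccessible ∧ B.Coaccessible := by
  constructor
  · intro h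
    have key : ∀ x y, (∃ x' ∈ A.final, Nonempty (A.P.Path x x')) ∧
        ∃ y' ∈ B.final, Nonempty (B.P.Path y y') := by
      intro x y
      obtain ⟨_, ⟨x₁, hx, y₁, hy, rfl⟩, ⟨ω⟩⟩ := h (tensorVertex x y)
      obtain ⟨x', y', hw, α, β, -⟩ := exists_paths_of_tensor A B ω _ _ rfl
      obtain ⟨rfl, rfl⟩ := tensorVertex_inj hw
      exact ⟨⟨_, hx, ⟨α⟩⟩, ⟨_, hy, ⟨β⟩⟩⟩
    exact ⟨fun x => (key x B.init).1, fun y => (key A.init y).2⟩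
  · rintro ⟨hA, hB⟩ v
    obtain ⟨x, y, rfl⟩ := exists_eq_tensorVertex v
    obtain ⟨x', hx, ⟨α⟩⟩ := hA x
    obtain ⟨y', hy, ⟨β⟩⟩ := hB y
    exact ⟨tensorVertex x' y', ⟨x', hx, y', hy, rfl⟩, ⟨(exists_tensor_path A B α β).choose⟩⟩

theorem mem_fundamentalMonoid_tensor (m : (A.alph.tensor B.alph).TraceMonoid) :
    m ∈ (A.tensor B).fundamentalMonoid ↔
      tensorFst A.alph B.alph m ∈ A.fundamentalMonoid ∧
        tensorSnd A.alph B.alph m ∈ B.fundamentalMonoid := by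
  constructor
  · rintro ⟨ω, hω⟩
    obtain ⟨x', y', hw, α, β, h⟩ := exists_paths_of_tensor A B ω _ _ rfl
    obtain ⟨rfl, rfl⟩ := tensorVertex_inj hw
    obtain rfl := h.symm.trans hω
    exact ⟨⟨α, by simp [pathTrace]⟩, ⟨β, by simp [pathTrace]⟩⟩
  · rintro ⟨⟨α, hα⟩, ⟨β, hβ⟩⟩
    obtain ⟨ω, hω⟩ := exists_tensor_path A B α β
    refine ⟨ω, hω.trans ?_⟩
    rw [tensor_eq_inl_mul_inr m, ← hα, ← hβ]
    rfl

/-- Projections are homomorphisms, so they preserve prefixes. Conversely, prefixes in the two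
factors combine, and the remainders `s` and `t` combine as well, by commutation. -/
theorem mem_traceLanguage_tensor (m : (A.alph.tensor B.alph).TraceMonoid) :
    m ∈ (A.tensor B).traceLanguage ↔
      tensorFst A.alph B.alph m ∈ A.traceLanguage ∧
        tensorSnd A.alph B.alph m ∈ B.traceLanguage := by
  constructor
  · rintro ⟨v, ω, t, hω⟩
    obtain ⟨x', y', rfl, α, β, h⟩ := exists_paths_of_tensor A B ω _ _ rfl
    have h := h.symm.trans hω
    have h1 := congrArg (tensorFst A.alph B.alph) h
    have h2 := congrArg (tensorSnd A.alph B.alph) h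
    rw [map_mul, tensorFst_inl, tensorFst_inr, mul_one] at h1
    rw [map_mul, tensorSnd_inl, tensorSnd_inr, one_mul] at h2
    exact ⟨⟨x', α, _, h1.trans (map_mul ..)⟩, ⟨y', β, _, h2.trans (map_mul ..)⟩⟩
  · rintro ⟨⟨x', α, s, hα⟩, ⟨y', β, t, hβ⟩⟩
    obtain ⟨ω, hω⟩ := exists_tensor_path A B α β
    refine ⟨_, ω, tensorInlTrace A.alph B.alph s * tensorInrTrace A.alph B.alph t, hω.trans ?_⟩
    rw [pathTrace, pathTrace, hα, hβ]
    conv_rhs => rw [tensor_eq_inl_mul_inr m]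
    rw [map_mul, map_mul]
    exact (tensor_commute _ _).mul_mul_mul_comm _ _

end HDA

/-! ## Invariants of a coproduct -/

namespace ConcurrentAlphabet

variable (S : ConcurrentAlphabet.{w₁}) (T : ConcurrentAlphabet.{w₂})

/-- The homomorphism from the trace monoid of the first summand of a coproduct. -/
def coprodInlTrace : S.TraceMonoid →* (S.coprod T).TraceMonoid :=
  mapTrace coprodInl fun _ _ h => h

/-- The homomorphism from the trace monoid of the second summand of a coproduct. -/
def coprodInrTrace : T.TraceMonoid →* (S.coprod T).TraceMonoid :=
  mapTrace coprodInr fun _ _ h => h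

variable {S T}

/-- The submonoid of the trace monoid of a coproduct that is generated by two submonoids of the
trace monoids of the summands. -/
def coprodSubmonoid (X : Submonoid S.TraceMonoid) (Y : Submonoid T.TraceMonoid) :
    Submonoid (S.coprod T).TraceMonoid :=
  X.map (coprodInlTrace S T) ⊔ Y.map (coprodInrTrace S T)

theorem coprodSubmonoid_mono {X X' : Submonoid S.TraceMonoid} {Y Y' : Submonoid T.TraceMonoid}
    (hX : X ≤ X') (hY : Y ≤ Y') : coprodSubmonoid X Y ≤ coprodSubmonoid X' Y' :=
  sup_le_sup (Submonoid.monotone_map hX) (Submonoid.monotone_map hY)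

theorem inl_mem_coprodSubmonoid {X : Submonoid S.TraceMonoid} (Y : Submonoid T.TraceMonoid)
    {m : S.TraceMonoid} (hm : m ∈ X) : coprodInlTrace S T m ∈ coprodSubmonoid X Y :=
  le_sup_left (a := X.map (coprodInlTrace S T)) (Submonoid.mem_map_of_mem _ hm)

theorem inr_mem_coprodSubmonoid (X : Submonoid S.TraceMonoid) {Y : Submonoid T.TraceMonoid}
    {m : T.TraceMonoid} (hm : m ∈ Y) : coprodInrTrace S T m ∈ coprodSubmonoid X Y :=
  le_sup_right (a := X.map (coprodInlTrace S T)) (Submonoid.mem_map_of_mem _ hm)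

end ConcurrentAlphabet

namespace PrecubicalSet

/-- Starting edges are iterated faces, so maps that commute with faces preserve them; this serves
for the inclusions of the summands of a coproduct. -/
theorem startEdge_map {P : PrecubicalSet.{u₁}} {Q : PrecubicalSet.{u₂}}
    {f : ∀ n, P.cube n → Q.cube n}
    (hf : ∀ {n : ℕ} (k : Fin 2) (i : Fin (n + 1)) (x : P.cube (n + 1)),
      Q.face k i (f (n + 1) x) = f n (P.face k i x)) {n : ℕ} (x : P.cube n) (i : Fin n) :
    Q.startEdge (f n x) i = f 1 (P.startEdge x i) := by
  induction n with
  | zero => exact i.elim0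
  | succ n ih =>
    cases n with
    | zero => rfl
    | succ n =>
      induction i using Fin.lastCases with
      | last => rw [startEdge_last, startEdge_last, hf, ih]
      | cast i => rw [startEdge_castSucc, startEdge_castSucc, hf, ih]

end PrecubicalSet

namespace HDA

universe u v w

open PrecubicalSet ConcurrentAlphabet

variable (A : HDA.{u₁, w₁}) (B : HDA.{u₂, w₂})

/-! ### Cubes of a coproduct -/

/-- The inclusion of the cubes of the first summand. -/
def coprodInl (n : ℕ) (x : A.P.cube n) : (A.coprod B).P.cube n :=
  (⟨⟨n, 0, rfl, x, B.init⟩, Or.inl ⟨x, rfl⟩⟩ : (wedge A B).carrier n)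

/-- The inclusion of the cubes of the second summand. -/
def coprodInr (n : ℕ) (y : B.P.cube n) : (A.coprod B).P.cube n :=
  (⟨⟨0, n, Nat.zero_add n, A.init, y⟩, Or.inr ⟨y, rfl⟩⟩ : (wedge A B).carrier n)

theorem eq_coprodInl_or_eq_coprodInr {n : ℕ} (c : (A.coprod B).P.cube n) :
    (∃ x, c = coprodInl A B n x) ∨ ∃ y, c = coprodInr A B n y := by
  obtain ⟨c, ⟨x, rfl⟩ | ⟨y, rfl⟩⟩ := c
  exacts [Or.inl ⟨x, rfl⟩, Or.inr ⟨y, rfl⟩]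

variable {A B} in
theorem coprodInl_inj {x x' : A.P.cube 0} (h : coprodInl A B 0 x = coprodInl A B 0 x') :
    x = x' := by
  cases h
  rfl

variable {A B} in
theorem coprodInr_inj {y y' : B.P.cube 0} (h : coprodInr A B 0 y = coprodInr A B 0 y') :
    y = y' := by
  cases h
  rfl

-- The summands share only the initial vertex, so this is the only place where a path can change
-- from one to the other.
variable {A B} in
theorem coprodInl_eq_coprodInr {x : A.P.cube 0} {y : B.P.cube 0}
    (h : coprodInl A B 0 x = coprodInr A B 0 y) : x = A.init ∧ y = B.init := by
  cases h
  exact ⟨rfl, rfl⟩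

theorem face_coprodInl {n : ℕ} (k : Fin 2) (i : Fin (n + 1)) (x : A.P.cube (n + 1)) :
    (A.coprod B).P.face k i (coprodInl A B (n + 1) x) = coprodInl A B n (A.P.face k i x) :=
  Subtype.ext (TensorCube.face_left (hi := i.2) ..)

theorem face_coprodInr {n : ℕ} (k : Fin 2) (i : Fin (n + 1)) (y : B.P.cube (n + 1)) :
    (A.coprod B).P.face k i (coprodInr A B (n + 1) y) = coprodInr A B n (B.P.face k i y) :=
  Subtype.ext (TensorCube.face_right (h := Nat.zero_add _) (hi := Nat.zero_le _) ..)

/-! ### Paths in a coproduct -/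

/-- The trace of the label of a path in a coproduct. -/
def coprodPathTrace {v w : (A.coprod B).P.cube 0} (ω : (A.coprod B).P.Path v w) :
    (A.alph.coprod B.alph).TraceMonoid :=
  (A.coprod B).pathTrace ω

theorem coprodPathTrace_comp {v w z : (A.coprod B).P.cube 0} (ω : (A.coprod B).P.Path v w)
    (ν : (A.coprod B).P.Path w z) :
    coprodPathTrace A B (ω.comp ν) = coprodPathTrace A B ω * coprodPathTrace A B ν :=
  pathTrace_comp ..

theorem coprodPathTrace_inl (x : A.P.cube 1) {v w : (A.coprod B).P.cube 0}
    (h : (A.coprod B).P.face 0 0 (coprodInl A B 1 x) = v)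
    (ω : (A.coprod B).P.Path ((A.coprod B).P.face 1 0 (coprodInl A B 1 x)) w) :
    coprodPathTrace A B (.cons (coprodInl A B 1 x) h ω) =
      coprodInlTrace A.alph B.alph (A.alph.trace (A.label x)) * coprodPathTrace A B ω :=
  (pathTrace_cons (A.coprod B) ..).trans (congrArg (· * coprodPathTrace A B ω)
    (mapTrace_trace ConcurrentAlphabet.coprodInl (fun _ _ h => h) (A.label x)).symm)

theorem coprodPathTrace_inr (y : B.P.cube 1) {v w : (A.coprod B).P.cube 0}
    (h : (A.coprod B).P.face 0 0 (coprodInr A B 1 y) = v)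
    (ω : (A.coprod B).P.Path ((A.coprod B).P.face 1 0 (coprodInr A B 1 y)) w) :
    coprodPathTrace A B (.cons (coprodInr A B 1 y) h ω) =
      coprodInrTrace A.alph B.alph (B.alph.trace (B.label y)) * coprodPathTrace A B ω :=
  (pathTrace_cons (A.coprod B) ..).trans (congrArg (· * coprodPathTrace A B ω)
    (mapTrace_trace ConcurrentAlphabet.coprodInr (fun _ _ h => h) (B.label y)).symm)

theorem exists_coprod_path_left {x x' : A.P.cube 0} (α : A.P.Path x x') :
    ∃ ω : (A.coprod B).P.Path (coprodInl A B 0 x) (coprodInl A B 0 x'),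
      coprodPathTrace A B ω = coprodInlTrace A.alph B.alph (A.pathTrace α) := by
  induction α with
  | nil x => exact ⟨.nil _, (map_one (coprodInlTrace A.alph B.alph)).symm⟩
  | cons e he α ih =>
    rw [← face_coprodInl] at ih
    obtain ⟨ω, hω⟩ := ih
    refine ⟨.cons (coprodInl A B 1 e) ((face_coprodInl A B 0 0 e).trans
      (congrArg (coprodInl A B 0) he)) ω, ?_⟩
    rw [pathTrace_cons A, map_mul, ← hω]
    exact coprodPathTrace_inl ..

theorem exists_coprod_path_right {y y' : B.P.cube 0} (β : B.P.Path y y') :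
    ∃ ω : (A.coprod B).P.Path (coprodInr A B 0 y) (coprodInr A B 0 y'),
      coprodPathTrace A B ω = coprodInrTrace A.alph B.alph (B.pathTrace β) := by
  induction β with
  | nil y => exact ⟨.nil _, (map_one (coprodInrTrace A.alph B.alph)).symm⟩
  | cons e he β ih =>
    rw [← face_coprodInr] at ih
    obtain ⟨ω, hω⟩ := ih
    refine ⟨.cons (coprodInr A B 1 e) ((face_coprodInr A B 0 0 e).trans
      (congrArg (coprodInr A B 0) he)) ω, ?_⟩
    rw [pathTrace_cons B, map_mul, ← hω]
    exact coprodPathTrace_inr ..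

/-- The vertex `v` is reached with trace `t` by loops in the summands, followed by a path in one
of the summands. -/
def CoprodReach (v : (A.coprod B).P.cube 0) (t : (A.alph.coprod B.alph).TraceMonoid) : Prop :=
  ∃ m ∈ coprodSubmonoid A.fundamentalMonoid B.fundamentalMonoid,
    (∃ x, v = coprodInl A B 0 x ∧ ∃ α : A.P.Path A.init x,
      t = m * coprodInlTrace A.alph B.alph (A.pathTrace α)) ∨
    ∃ y, v = coprodInr A B 0 y ∧ ∃ β : B.P.Path B.init y,
      t = m * coprodInrTrace A.alph B.alph (B.pathTrace β)

variable {A B}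

/-- At the initial vertex the final piece of the path is itself a loop in a summand. -/
theorem CoprodReach.init_mem {t : (A.alph.coprod B.alph).TraceMonoid}
    (h : CoprodReach A B (A.coprod B).init t) :
    t ∈ coprodSubmonoid A.fundamentalMonoid B.fundamentalMonoid := by
  obtain ⟨m, hm, ⟨x, hx, α, rfl⟩ | ⟨y, hy, β, rfl⟩⟩ := h
  · obtain rfl := coprodInl_inj hx
    exact mul_mem hm (inl_mem_coprodSubmonoid _ ⟨α, rfl⟩)
  · obtain rfl := coprodInr_inj hy
    exact mul_mem hm (inr_mem_coprodSubmonoid _ ⟨β, rfl⟩)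

theorem pathTrace_comp_edge {A : HDA.{u, w}} {v : A.P.cube 0} (e : A.P.cube 1)
    (α : A.P.Path v (A.P.face 0 0 e)) :
    A.pathTrace (α.comp (.cons e rfl (.nil _))) = A.pathTrace α * A.alph.trace (A.label e) := by
  rw [pathTrace_comp, pathTrace_cons, pathTrace_nil, mul_one]

/-- If the current final piece lies in `A`, the edge prolongs it. If it lies in `B`, it has ended in
the initial vertex; it is then a loop, which is absorbed in `m`, and the edge starts a new final
piece. -/
theorem CoprodReach.inl {e : A.P.cube 1} {t : (A.alph.coprod B.alph).TraceMonoid}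
    (h : CoprodReach A B (coprodInl A B 0 (A.P.face 0 0 e)) t) :
    CoprodReach A B (coprodInl A B 0 (A.P.face 1 0 e))
      (t * coprodInlTrace A.alph B.alph (A.alph.trace (A.label e))) := by
  obtain ⟨m, hm, ⟨x, hx, α, rfl⟩ | ⟨y, hy, β, rfl⟩⟩ := h
  · obtain rfl := coprodInl_inj hx
    refine ⟨m, hm, Or.inl ⟨_, rfl, α.comp (.cons e rfl (.nil _)), ?_⟩⟩
    rw [pathTrace_comp_edge, map_mul, mul_assoc]
  · obtain ⟨hx, rfl⟩ := coprodInl_eq_coprodInr hy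
    refine ⟨_, mul_mem hm (inr_mem_coprodSubmonoid _ ⟨β, rfl⟩),
      Or.inl ⟨_, rfl, .cons e hx (.nil _), ?_⟩⟩
    rw [pathTrace_cons, pathTrace_nil, mul_one]
    rfl

theorem CoprodReach.inr {e : B.P.cube 1} {t : (A.alph.coprod B.alph).TraceMonoid}
    (h : CoprodReach A B (coprodInr A B 0 (B.P.face 0 0 e)) t) :
    CoprodReach A B (coprodInr A B 0 (B.P.face 1 0 e))
      (t * coprodInrTrace A.alph B.alph (B.alph.trace (B.label e))) := by
  obtain ⟨m, hm, ⟨x, hx, α, rfl⟩ | ⟨y, hy, β, rfl⟩⟩ := h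
  · obtain ⟨rfl, hy⟩ := coprodInl_eq_coprodInr hx.symm
    refine ⟨_, mul_mem hm (inl_mem_coprodSubmonoid _ ⟨α, rfl⟩),
      Or.inr ⟨_, rfl, .cons e hy (.nil _), ?_⟩⟩
    rw [pathTrace_cons, pathTrace_nil, mul_one]
    rfl
  · obtain rfl := coprodInr_inj hy
    refine ⟨m, hm, Or.inr ⟨_, rfl, β.comp (.cons e rfl (.nil _)), ?_⟩⟩
    rw [pathTrace_comp_edge, map_mul, mul_assoc]

/-- Paths are built from the front while `CoprodReach` grows at the end, so the induction carries
the trace `t` already read. -/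
theorem CoprodReach.path {v w : (A.coprod B).P.cube 0} (ω : (A.coprod B).P.Path v w) :
    ∀ t, CoprodReach A B v t → CoprodReach A B w (t * coprodPathTrace A B ω) := by
  induction ω with
  | nil v => exact fun t h => (mul_one t).symm ▸ h
  | cons e he ω ih =>
    intro t ht
    obtain ⟨x, rfl⟩ | ⟨y, rfl⟩ := eq_coprodInl_or_eq_coprodInr A B e
    · rw [coprodPathTrace_inl, ← mul_assoc]
      refine ih _ ?_
      rw [← he, face_coprodInl] at ht
      rw [face_coprodInl]
      exact ht.inl
    · rw [coprodPathTrace_inr, ← mul_assoc]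
      refine ih _ ?_
      rw [← he, face_coprodInr] at ht
      rw [face_coprodInr]
      exact ht.inr

theorem CoprodReach.of_path {v : (A.coprod B).P.cube 0}
    (ω : (A.coprod B).P.Path (A.coprod B).init v) :
    CoprodReach A B v (coprodPathTrace A B ω) := by
  have h : CoprodReach A B (A.coprod B).init 1 :=
    ⟨1, one_mem _, Or.inl ⟨A.init, rfl, .nil _, by rw [pathTrace_nil, map_one, mul_one]⟩⟩
  simpa using h.path ω

variable (A B)

theorem fundamentalMonoid_coprod :
    (A.coprod B).fundamentalMonoid =
      coprodSubmonoid A.fundamentalMonoid B.fundamentalMonoid := by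
  apply le_antisymm
  · rintro _ ⟨ω, rfl⟩
    exact (CoprodReach.of_path ω).init_mem
  · refine sup_le ?_ ?_
    · rintro _ ⟨_, ⟨α, rfl⟩, rfl⟩
      exact exists_coprod_path_left A B α
    · rintro _ ⟨_, ⟨β, rfl⟩, rfl⟩
      exact exists_coprod_path_right A B β

/-- The trace language of a coproduct, in terms of invariants of the summands. -/
def coprodLanguage {S : ConcurrentAlphabet.{w₁}} {T : ConcurrentAlphabet.{w₂}}
    (X : Submonoid S.TraceMonoid) (Y : Submonoid T.TraceMonoid) (K : Set S.TraceMonoid)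
    (L : Set T.TraceMonoid) : Set (S.coprod T).TraceMonoid :=
  {v | ∃ m ∈ coprodSubmonoid X Y, (∃ a ∈ K, ∃ t, m * coprodInlTrace S T a = v * t) ∨
    ∃ b ∈ L, ∃ t, m * coprodInrTrace S T b = v * t}

theorem coprodLanguage_mono {S : ConcurrentAlphabet.{w₁}} {T : ConcurrentAlphabet.{w₂}}
    {X X' : Submonoid S.TraceMonoid} {Y Y' : Submonoid T.TraceMonoid} {K K' : Set S.TraceMonoid}
    {L L' : Set T.TraceMonoid} (hX : X ≤ X') (hY : Y ≤ Y') (hK : K ⊆ K') (hL : L ⊆ L') :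
    coprodLanguage X Y K L ⊆ coprodLanguage X' Y' K' L' := by
  rintro v ⟨m, hm, ⟨a, ha, h⟩ | ⟨b, hb, h⟩⟩
  · exact ⟨m, coprodSubmonoid_mono hX hY hm, Or.inl ⟨a, hK ha, h⟩⟩
  · exact ⟨m, coprodSubmonoid_mono hX hY hm, Or.inr ⟨b, hL hb, h⟩⟩

theorem traceLanguage_coprod :
    (A.coprod B).traceLanguage = coprodLanguage A.fundamentalMonoid B.fundamentalMonoid
      A.traceLanguage B.traceLanguage := by
  apply subset_antisymm
  · rintro v ⟨x, ω, t, h⟩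
    have h : coprodPathTrace A B ω = v * t := h
    obtain ⟨m, hm, ⟨x, hx, α, hα⟩ | ⟨y, hy, β, hβ⟩⟩ := CoprodReach.of_path ω
    -- The full trace of `α` is a prefix of itself, with remainder `1`.
    · exact ⟨m, hm, Or.inl ⟨A.pathTrace α, ⟨x, α, 1, (mul_one _).symm⟩, t, hα.symm.trans h⟩⟩
    · exact ⟨m, hm, Or.inr ⟨B.pathTrace β, ⟨y, β, 1, (mul_one _).symm⟩, t, hβ.symm.trans h⟩⟩
  · rintro (v : (A.alph.coprod B.alph).TraceMonoid) ⟨m, hm, ⟨a, ⟨x, α, s, hα⟩, t, h⟩ | ⟨b, ⟨y, β, s, hβ⟩, t, h⟩⟩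
    all_goals
      have hm' : m ∈ (A.coprod B).fundamentalMonoid := (fundamentalMonoid_coprod A B).ge hm
      obtain ⟨ν, hν⟩ := hm'
      replace hν : coprodPathTrace A B ν = m := hν
    -- The loop `ν` realizes `m`, and `α` realizes `a` followed by `s`; so `v` is a prefix of the
    -- trace of the concatenation, with remainder `t` times the image of `s`.
    · obtain ⟨ω, hω⟩ := exists_coprod_path_left A B α
      refine ⟨_, ν.comp ω, t * coprodInlTrace A.alph B.alph s,
        (coprodPathTrace_comp A B ν ω).trans ?_⟩
      refine Eq.trans ?_ (mul_assoc ..)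
      refine (congrArg₂ (· * ·) hν hω).trans ?_
      rw [pathTrace, hα, map_mul, ← mul_assoc, h]
    · obtain ⟨ω, hω⟩ := exists_coprod_path_right A B β
      refine ⟨_, ν.comp ω, t * coprodInrTrace A.alph B.alph s,
        (coprodPathTrace_comp A B ν ω).trans ?_⟩
      refine Eq.trans ?_ (mul_assoc ..)
      refine (congrArg₂ (· * ·) hν hω).trans ?_
      rw [pathTrace, hβ, map_mul, ← mul_assoc, h]

theorem accessible_coprod : (A.coprod B).Accessible ↔ A.Accessible ∧ B.Accessible := by
  constructor
  · refine fun h => ⟨fun x => ?_, fun y => ?_⟩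
    · obtain ⟨ω⟩ := h (coprodInl A B 0 x)
      obtain ⟨m, hm, ⟨x', hx, α, -⟩ | ⟨y, hy, β, -⟩⟩ := CoprodReach.of_path ω
      · obtain rfl := coprodInl_inj hx
        exact ⟨α⟩
      -- A vertex of `A` reached by a final piece in `B` is the initial one.
      · rw [(coprodInl_eq_coprodInr hy).1]
        exact ⟨.nil _⟩
    · obtain ⟨ω⟩ := h (coprodInr A B 0 y)
      obtain ⟨m, hm, ⟨x, hx, α, -⟩ | ⟨y', hy, β, -⟩⟩ := CoprodReach.of_path ω
      · rw [(coprodInl_eq_coprodInr hx.symm).2]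
        exact ⟨.nil _⟩
      · obtain rfl := coprodInr_inj hy
        exact ⟨β⟩
  · rintro ⟨hA, hB⟩ c
    obtain ⟨x, rfl⟩ | ⟨y, rfl⟩ := eq_coprodInl_or_eq_coprodInr A B c
    · obtain ⟨α⟩ := hA x
      exact ⟨(exists_coprod_path_left A B α).choose⟩
    · obtain ⟨β⟩ := hB y
      exact ⟨(exists_coprod_path_right A B β).choose⟩

/-- There is no converse: inside the coproduct a state of `A` may reach a final state of `B` through
the initial vertex. -/
theorem Coaccessible.coprod {A : HDA.{u₁, w₁}} {B : HDA.{u₂, w₂}} (hA : A.Coaccessible)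
    (hB : B.Coaccessible) : (A.coprod B).Coaccessible := by
  intro c
  obtain ⟨x, rfl⟩ | ⟨y, rfl⟩ := eq_coprodInl_or_eq_coprodInr A B c
  · obtain ⟨x', hx, ⟨α⟩⟩ := hA x
    exact ⟨coprodInl A B 0 x', Or.inl ⟨x', hx, rfl⟩, ⟨(exists_coprod_path_left A B α).choose⟩⟩
  · obtain ⟨y', hy, ⟨β⟩⟩ := hB y
    exact ⟨coprodInr A B 0 y', Or.inr ⟨y', hy, rfl⟩, ⟨(exists_coprod_path_right A B β).choose⟩⟩

/-! ### The homology language of a coproduct -/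

section HomologyLanguage

variable (R : Type v) [CommRing R]

/-- The labeling of chains of a coproduct. -/
noncomputable def coprodLabeling (n : ℕ) :
    (A.coprod B).P.Chain R n →ₗ[R] Ext R (A.alph.coprod B.alph) :=
  labeling R (A.coprod B) n

theorem labeling_coprodInl {n : ℕ} (x : A.P.cube n) :
    coprodLabeling A B R n ((A.coprod B).P.cubeBasis R n (coprodInl A B n x)) =
      mapExt R (ConcurrentAlphabet.coprodInl (T := B.alph))
        (labeling R A n (A.P.cubeBasis R n x)) := by
  have h (i : Fin n) : (A.coprod B).label ((A.coprod B).P.startEdge (coprodInl A B n x) i) =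
      FreeMonoid.map ConcurrentAlphabet.coprodInl (A.label (A.P.startEdge x i)) :=
    congrArg (A.coprod B).label
      (startEdge_map (f := coprodInl A B) (face_coprodInl A B) x i)
  refine (labeling_cube R (A.coprod B) _).trans ?_
  rw [labeling_cube, mapExt_prod]
  simp only [h]
  rfl

theorem labeling_coprodInr {n : ℕ} (y : B.P.cube n) :
    coprodLabeling A B R n ((A.coprod B).P.cubeBasis R n (coprodInr A B n y)) =
      mapExt R (ConcurrentAlphabet.coprodInr (S := A.alph))
        (labeling R B n (B.P.cubeBasis R n y)) := by
  have h (i : Fin n) : (A.coprod B).label ((A.coprod B).P.startEdge (coprodInr A B n y) i) =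
      FreeMonoid.map ConcurrentAlphabet.coprodInr (B.label (B.P.startEdge y i)) :=
    congrArg (A.coprod B).label
      (startEdge_map (f := coprodInr A B) (face_coprodInr A B) y i)
  refine (labeling_cube R (A.coprod B) _).trans ?_
  rw [labeling_cube, mapExt_prod]
  simp only [h]
  rfl

end HomologyLanguage

end HDA

/-! ### Chain maps between a coproduct and its summands -/

namespace PrecubicalSet

universe v

/-- The map of chains induced by a map of cubes. -/
noncomputable def mapChain {P : PrecubicalSet.{u₁}} {Q : PrecubicalSet.{u₂}} (R : Type v)
    [CommRing R] (f : ∀ n, P.cube n → Q.cube n) (n : ℕ) : P.Chain R n →ₗ[R] Q.Chain R n :=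
  (P.cubeBasis R n).constr R fun x => Q.cubeBasis R n (f n x)

theorem mapChain_cube {P : PrecubicalSet.{u₁}} {Q : PrecubicalSet.{u₂}} (R : Type v)
    [CommRing R] (f : ∀ n, P.cube n → Q.cube n) {n : ℕ} (x : P.cube n) :
    mapChain R f n (P.cubeBasis R n x) = Q.cubeBasis R n (f n x) :=
  Module.Basis.constr_basis ..

theorem mapChain_boundary {P : PrecubicalSet.{u₁}} {Q : PrecubicalSet.{u₂}} (R : Type v)
    [CommRing R] {f : ∀ n, P.cube n → Q.cube n}
    (hf : ∀ {n : ℕ} (k : Fin 2) (i : Fin (n + 1)) (x : P.cube (n + 1)),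
      Q.face k i (f (n + 1) x) = f n (P.face k i x)) (n : ℕ) (z : P.Chain R (n + 1)) :
    Q.boundary R n (mapChain R f (n + 1) z) = mapChain R f n (P.boundary R n z) := by
  refine LinearMap.congr_fun (f := Q.boundary R n ∘ₗ mapChain R f (n + 1))
    (g := mapChain R f n ∘ₗ P.boundary R n) ?_ z
  refine (P.cubeBasis R (n + 1)).ext fun x => ?_
  simp [mapChain_cube, boundary_cube, hf]

/-- Linear maps that commute with the boundary operators preserve cycles. -/
theorem map_mem_cycles {P : PrecubicalSet.{u₁}} {Q : PrecubicalSet.{u₂}} {R : Type v}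
    [CommRing R] {g : ∀ n, P.Chain R n →ₗ[R] Q.Chain R n}
    (hg : ∀ n z, Q.boundary R n (g (n + 1) z) = g n (P.boundary R n z)) {n : ℕ}
    {z : P.Chain R n} (hz : z ∈ P.cycles R n) : g n z ∈ Q.cycles R n := by
  cases n with
  | zero => trivial
  | succ n =>
    rw [cycles, LinearMap.mem_ker] at hz ⊢
    rw [hg, hz, map_zero]

end PrecubicalSet

namespace HDA

universe u v w

open PrecubicalSet ConcurrentAlphabet

variable (A : HDA.{u₁, w₁}) (B : HDA.{u₂, w₂}) (R : Type v) [CommRing R]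

theorem coprodLabeling_mapChain_inl {n : ℕ} (z : A.P.Chain R n) :
    coprodLabeling A B R n (mapChain R (coprodInl A B) n z) =
      mapExt R (ConcurrentAlphabet.coprodInl (T := B.alph)) (labeling R A n z) := by
  refine LinearMap.congr_fun (f := coprodLabeling A B R n ∘ₗ mapChain R (coprodInl A B) n)
    (g := (mapExt R (ConcurrentAlphabet.coprodInl (T := B.alph))).toLinearMap ∘ₗ
      labeling R A n) ?_ z
  refine (A.P.cubeBasis R n).ext fun x => ?_
  rw [LinearMap.comp_apply, mapChain_cube]
  exact labeling_coprodInl ..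

theorem coprodLabeling_mapChain_inr {n : ℕ} (z : B.P.Chain R n) :
    coprodLabeling A B R n (mapChain R (coprodInr A B) n z) =
      mapExt R (ConcurrentAlphabet.coprodInr (S := A.alph)) (labeling R B n z) := by
  refine LinearMap.congr_fun (f := coprodLabeling A B R n ∘ₗ mapChain R (coprodInr A B) n)
    (g := (mapExt R (ConcurrentAlphabet.coprodInr (S := A.alph))).toLinearMap ∘ₗ
      labeling R B n) ?_ z
  refine (B.P.cubeBasis R n).ext fun x => ?_
  rw [LinearMap.comp_apply, mapChain_cube]
  exact labeling_coprodInr ..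

/-- The chain map to the first summand that collapses the second summand. -/
noncomputable def coprodFst (n : ℕ) : (A.coprod B).P.Chain R n →ₗ[R] A.P.Chain R n :=
  ((A.coprod B).P.cubeBasis R n).constr R fun c : (wedge A B).carrier n =>
    if h : c.1.q = 0 then
      A.P.cubeBasis R n ((show c.1.p = n by have := c.1.add_eq; omega) ▸ c.1.fst)
    else 0

/-- The chain map to the second summand that collapses the first summand. -/
noncomputable def coprodSnd (n : ℕ) : (A.coprod B).P.Chain R n →ₗ[R] B.P.Chain R n :=
  ((A.coprod B).P.cubeBasis R n).constr R fun c : (wedge A B).carrier n =>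
    if h : c.1.p = 0 then
      B.P.cubeBasis R n ((show c.1.q = n by have := c.1.add_eq; omega) ▸ c.1.snd)
    else 0

theorem coprodFst_inl {n : ℕ} (x : A.P.cube n) :
    coprodFst A B R n ((A.coprod B).P.cubeBasis R n (coprodInl A B n x)) =
      A.P.cubeBasis R n x :=
  (Module.Basis.constr_basis ..).trans (dif_pos rfl)

/-- In degree `0` the test `q = 0` also succeeds for vertices of `B`, whose first coordinate is
`A.init`. So `B` collapses to the base vertex and not to `0`, which keeps the vertex label `1`. -/
theorem coprodFst_inr_zero (y : B.P.cube 0) :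
    coprodFst A B R 0 ((A.coprod B).P.cubeBasis R 0 (coprodInr A B 0 y)) =
      A.P.cubeBasis R 0 A.init :=
  (Module.Basis.constr_basis ..).trans (dif_pos rfl)

theorem coprodFst_inr_succ {n : ℕ} (y : B.P.cube (n + 1)) :
    coprodFst A B R (n + 1) ((A.coprod B).P.cubeBasis R (n + 1) (coprodInr A B (n + 1) y)) = 0 :=
  (Module.Basis.constr_basis ..).trans (dif_neg n.succ_ne_zero)

theorem coprodSnd_inr {n : ℕ} (y : B.P.cube n) :
    coprodSnd A B R n ((A.coprod B).P.cubeBasis R n (coprodInr A B n y)) =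
      B.P.cubeBasis R n y :=
  (Module.Basis.constr_basis ..).trans (dif_pos rfl)

theorem coprodSnd_inl_zero (x : A.P.cube 0) :
    coprodSnd A B R 0 ((A.coprod B).P.cubeBasis R 0 (coprodInl A B 0 x)) =
      B.P.cubeBasis R 0 B.init :=
  (Module.Basis.constr_basis ..).trans (dif_pos rfl)

theorem coprodSnd_inl_succ {n : ℕ} (x : A.P.cube (n + 1)) :
    coprodSnd A B R (n + 1) ((A.coprod B).P.cubeBasis R (n + 1) (coprodInl A B (n + 1) x)) = 0 :=
  (Module.Basis.constr_basis ..).trans (dif_neg n.succ_ne_zero)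

theorem coprodFst_boundary (n : ℕ) (z : (A.coprod B).P.Chain R (n + 1)) :
    A.P.boundary R n (coprodFst A B R (n + 1) z) =
      coprodFst A B R n ((A.coprod B).P.boundary R n z) := by
  refine LinearMap.congr_fun (f := A.P.boundary R n ∘ₗ coprodFst A B R (n + 1))
    (g := coprodFst A B R n ∘ₗ (A.coprod B).P.boundary R n) ?_ z
  refine ((A.coprod B).P.cubeBasis R (n + 1)).ext fun c => ?_
  obtain ⟨x, rfl⟩ | ⟨y, rfl⟩ := eq_coprodInl_or_eq_coprodInr A B c
  · simp [boundary_cube, face_coprodInl, coprodFst_inl]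
  -- Both ends of an edge of `B` become `A.init` and cancel; in higher degrees all terms vanish.
  · cases n <;> simp [boundary_cube, face_coprodInr, coprodFst_inr_succ, coprodFst_inr_zero]

theorem coprodSnd_boundary (n : ℕ) (z : (A.coprod B).P.Chain R (n + 1)) :
    B.P.boundary R n (coprodSnd A B R (n + 1) z) =
      coprodSnd A B R n ((A.coprod B).P.boundary R n z) := by
  refine LinearMap.congr_fun (f := B.P.boundary R n ∘ₗ coprodSnd A B R (n + 1))
    (g := coprodSnd A B R n ∘ₗ (A.coprod B).P.boundary R n) ?_ z
  refine ((A.coprod B).P.cubeBasis R (n + 1)).ext fun c => ?_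
  obtain ⟨x, rfl⟩ | ⟨y, rfl⟩ := eq_coprodInl_or_eq_coprodInr A B c
  · cases n <;> simp [boundary_cube, face_coprodInl, coprodSnd_inl_succ, coprodSnd_inl_zero]
  · simp [boundary_cube, face_coprodInr, coprodSnd_inr]

theorem labeling_vertex (A : HDA.{u, w}) (x : A.P.cube 0) :
    labeling R A 0 (A.P.cubeBasis R 0 x) = 1 := by
  rw [labeling_cube]
  simp

/-- Every vertex has label `1`, and both projections send vertices to vertices, so adding both would
count each vertex twice; one projection suffices. -/
theorem coprodLabeling_zero (z : (A.coprod B).P.Chain R 0) :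
    coprodLabeling A B R 0 z = mapExt R (ConcurrentAlphabet.coprodInl (T := B.alph))
      (labeling R A 0 (coprodFst A B R 0 z)) := by
  refine LinearMap.congr_fun (f := coprodLabeling A B R 0)
    (g := (mapExt R (ConcurrentAlphabet.coprodInl (T := B.alph))).toLinearMap ∘ₗ
      labeling R A 0 ∘ₗ coprodFst A B R 0) ?_ z
  refine ((A.coprod B).P.cubeBasis R 0).ext fun c => ?_
  refine (labeling_vertex R (A.coprod B) c).trans ?_
  obtain ⟨x, rfl⟩ | ⟨y, rfl⟩ := eq_coprodInl_or_eq_coprodInr A B c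
  · simp only [LinearMap.comp_apply, coprodFst_inl, labeling_vertex]
    exact (map_one (mapExt R _)).symm
  · simp only [LinearMap.comp_apply, coprodFst_inr_zero, labeling_vertex]
    exact (map_one (mapExt R _)).symm

/-- A cube of positive degree lies in one summand only, and the projection to the other kills it. -/
theorem coprodLabeling_succ (n : ℕ) (z : (A.coprod B).P.Chain R (n + 1)) :
    coprodLabeling A B R (n + 1) z =
      mapExt R (ConcurrentAlphabet.coprodInl (T := B.alph))
        (labeling R A (n + 1) (coprodFst A B R (n + 1) z)) +
      mapExt R (ConcurrentAlphabet.coprodInr (S := A.alph))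
        (labeling R B (n + 1) (coprodSnd A B R (n + 1) z)) := by
  refine LinearMap.congr_fun (f := coprodLabeling A B R (n + 1))
    (g := (mapExt R (ConcurrentAlphabet.coprodInl (T := B.alph))).toLinearMap ∘ₗ
      labeling R A (n + 1) ∘ₗ coprodFst A B R (n + 1) +
      (mapExt R (ConcurrentAlphabet.coprodInr (S := A.alph))).toLinearMap ∘ₗ
      labeling R B (n + 1) ∘ₗ coprodSnd A B R (n + 1)) ?_ z
  refine ((A.coprod B).P.cubeBasis R (n + 1)).ext fun c => ?_
  rw [LinearMap.add_apply]
  obtain ⟨x, rfl⟩ | ⟨y, rfl⟩ := eq_coprodInl_or_eq_coprodInr A B c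
  · simp only [LinearMap.comp_apply, coprodFst_inl, coprodSnd_inl_succ, map_zero, add_zero]
    exact labeling_coprodInl ..
  · simp only [LinearMap.comp_apply, coprodFst_inr_succ, coprodSnd_inr, map_zero, zero_add]
    exact labeling_coprodInr ..

/-- The sum of two graded submodules of the exterior algebras over the summands of a coproduct. -/
noncomputable def sumLanguage {S : ConcurrentAlphabet.{w₁}} {T : ConcurrentAlphabet.{w₂}}
    (X : ℕ → Submodule R (Ext R S)) (Y : ℕ → Submodule R (Ext R T)) (n : ℕ) :
    Submodule R (Ext R (S.coprod T)) :=
  (X n).map (mapExt R (ConcurrentAlphabet.coprodInl (T := T))).toLinearMap ⊔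
    (Y n).map (mapExt R (ConcurrentAlphabet.coprodInr (S := S))).toLinearMap

theorem sumLanguage_mono {S : ConcurrentAlphabet.{w₁}} {T : ConcurrentAlphabet.{w₂}}
    {X X' : ℕ → Submodule R (Ext R S)} {Y Y' : ℕ → Submodule R (Ext R T)}
    (hX : ∀ n, X n ≤ X' n) (hY : ∀ n, Y n ≤ Y' n) (n : ℕ) :
    sumLanguage R X Y n ≤ sumLanguage R X' Y' n :=
  sup_le_sup (Submodule.map_mono (hX n)) (Submodule.map_mono (hY n))

/-- The collapsing maps and the inclusions are chain maps compatible with labels, so cycles can be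
split and recombined over any commutative ring. -/
theorem homologyLanguage_coprod (n : ℕ) : homologyLanguage R (A.coprod B) n =
    sumLanguage R (homologyLanguage R A) (homologyLanguage R B) n := by
  apply le_antisymm
  · intro c hc
    obtain ⟨z, hz, rfl⟩ := (mem_homologyLanguage R).1 hc
    have h1 := (mem_homologyLanguage R).2
      ⟨_, map_mem_cycles (coprodFst_boundary A B R) hz, rfl⟩
    have h2 := (mem_homologyLanguage R).2
      ⟨_, map_mem_cycles (coprodSnd_boundary A B R) hz, rfl⟩
    cases n with
    | zero =>
      have h : coprodLabeling A B R 0 z ∈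
          sumLanguage R (homologyLanguage R A) (homologyLanguage R B) 0 := by
        rw [coprodLabeling_zero]
        exact Submodule.mem_sup_left (Submodule.mem_map_of_mem h1)
      exact h
    | succ n =>
      have h : coprodLabeling A B R (n + 1) z ∈
          sumLanguage R (homologyLanguage R A) (homologyLanguage R B) (n + 1) := by
        rw [coprodLabeling_succ]
        exact Submodule.add_mem_sup (Submodule.mem_map_of_mem h1) (Submodule.mem_map_of_mem h2)
      exact h
  · refine sup_le ?_ ?_
    · rintro _ ⟨a, ha, rfl⟩
      obtain ⟨z, hz, rfl⟩ := (mem_homologyLanguage R).1 ha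
      exact (mem_homologyLanguage R).2
        ⟨_, map_mem_cycles (mapChain_boundary R (face_coprodInl A B)) hz,
          coprodLabeling_mapChain_inl A B R z⟩
    · rintro _ ⟨b, hb, rfl⟩
      obtain ⟨z, hz, rfl⟩ := (mem_homologyLanguage R).1 hb
      exact (mem_homologyLanguage R).2
        ⟨_, map_mem_cycles (mapChain_boundary R (face_coprodInr A B)) hz,
          coprodLabeling_mapChain_inr A B R z⟩

/-! ### Weak implementation -/

variable {A B} {A' : HDA.{u₃, w₁}} {B' : HDA.{u₄, w₂}} {R}

theorem WeaklyImplements.tensor [IsDomain R] [IsPrincipalIdealRing R]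
    (hA : WeaklyImplements R A A') (hB : WeaklyImplements R B B') :
    WeaklyImplements R (A.tensor B) (A'.tensor B') := by
  obtain ⟨⟨hA1, hA2⟩, eA, ⟨hA3, hA4⟩, hA5⟩ := hA
  obtain ⟨⟨hB1, hB2⟩, eB, ⟨hB3, hB4⟩, hB5⟩ := hB
  refine ⟨⟨fun h => ?_, fun h => ?_⟩, ?_⟩
  · rw [accessible_tensor] at h ⊢
    exact ⟨hA1 h.1, hB1 h.2⟩
  · rw [coaccessible_tensor] at h ⊢
    exact ⟨hA2 h.1, hB2 h.2⟩
  clear hA1 hA2 hB1 hB2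
  -- With the automata taken apart, the alphabets are variables; identifying them makes the
  -- transports in `WeaklyImplements` trivial.
  obtain ⟨P, i, F, S, l, hl, hi⟩ := A
  obtain ⟨P', i', F', S', l', hl', hi'⟩ := A'
  obtain ⟨Q, j, G, T, k, hk, hj⟩ := B
  obtain ⟨Q', j', G', T', k', hk', hj'⟩ := B'
  change S = S' at eA
  change T = T' at eB
  subst eA
  subst eB
  refine ⟨rfl, ⟨fun m hm => ?_, fun m hm => ?_⟩, fun n => ?_⟩
  · refine (mem_fundamentalMonoid_tensor _ _ m).2 ?_
    have := (mem_fundamentalMonoid_tensor (.mk P i F S l hl hi) (.mk Q j G T k hk hj) m).1 hm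
    exact ⟨hA3 this.1, hB3 this.2⟩
  · refine (mem_traceLanguage_tensor _ _ m).2 ?_
    have := (mem_traceLanguage_tensor (.mk P i F S l hl hi) (.mk Q j G T k hk hj) m).1 hm
    exact ⟨hA4 this.1, hB4 this.2⟩
  · exact (homologyLanguage_tensor R _ _ n).le.trans ((productLanguage_mono R hA5 hB5 n).trans
      (homologyLanguage_tensor R _ _ n).ge)

theorem WeaklyImplements.coprod (hcA : A.Coaccessible) (hcB : B.Coaccessible)
    (hA : WeaklyImplements R A A') (hB : WeaklyImplements R B B') :
    WeaklyImplements R (A.coprod B) (A'.coprod B') := by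
  obtain ⟨⟨hA1, -⟩, eA, ⟨hA3, hA4⟩, hA5⟩ := hA
  obtain ⟨⟨hB1, -⟩, eB, ⟨hB3, hB4⟩, hB5⟩ := hB
  refine ⟨⟨fun h => ?_, fun _ => hcA.coprod hcB⟩, ?_⟩
  · rw [accessible_coprod] at h ⊢
    exact ⟨hA1 h.1, hB1 h.2⟩
  clear hA1 hB1 hcA hcB
  obtain ⟨P, i, F, S, l, hl, hi⟩ := A
  obtain ⟨P', i', F', S', l', hl', hi'⟩ := A'
  obtain ⟨Q, j, G, T, k, hk, hj⟩ := B
  obtain ⟨Q', j', G', T', k', hk', hj'⟩ := B'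
  change S = S' at eA
  change T = T' at eB
  subst eA
  subst eB
  refine ⟨rfl, ⟨?_, ?_⟩, fun n => ?_⟩
  · exact (fundamentalMonoid_coprod _ _).le.trans ((coprodSubmonoid_mono hA3 hB3).trans
      (fundamentalMonoid_coprod _ _).ge)
  · exact (traceLanguage_coprod _ _).le.trans ((coprodLanguage_mono hA3 hB3 hA4 hB4).trans
      (traceLanguage_coprod _ _).ge)
  · exact (homologyLanguage_coprod _ _ R n).le.trans ((sumLanguage_mono R hA5 hB5 n).trans
      (homologyLanguage_coprod _ _ R n).ge)

end HDA

/-! ### The corollary -/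

theorem mainTheorem2
    {R : Type r} [CommRing R] [IsDomain R] [IsPrincipalIdealRing R]
    (A : HDA.{u₁, w₁}) (A' : HDA.{u₂, w₁}) (B : HDA.{u₃, w₂}) (B' : HDA.{u₄, w₂})
    (hA : HDA.WeaklyEquivalent R A A') (hB : HDA.WeaklyEquivalent R B B') :
    HDA.WeaklyEquivalent R (A.tensor B) (A'.tensor B') ∧
      (A.Coaccessible → A'.Coaccessible → B.Coaccessible → B'.Coaccessible →
        HDA.WeaklyEquivalent R (A.coprod B) (A'.coprod B')) :=
  ⟨⟨hA.1.tensor hB.1, hA.2.tensor hB.2⟩, fun cA cA' cB cB' =>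
    ⟨hA.1.coprod cA cB hB.1, hA.2.coprod cA' cB' hB.2⟩⟩
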